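/- **Setting.** Let $\rho_m$ be a quadratic spline on $[0,\infty)$ with $m$ knots, $0$ being one of them ($\rho_m$ is $C^1$ and is a polynomial of degree at most $2$ between consecutive knots and beyond the last one), and put $\rho(t;\lambda)=\lambda^2\rho_m(t/\lambda)$, $\dot\rho(t;\lambda)=\frac{\partial}{\partial t}\rho(t;\lambda)$. Assume that for some $\gamma>0$ and all $\lambda>0$, $\dot\rho(t;\lambda)=0$ for all $t\ge\gamma\lambda$ and $\dot\rho(0+;\lambda)=\lambda$. Let $\kappa(\rho_m;1)=\max_{t>0}\{-\ddot\rho_m(t)\}$ be the maximum concavity (the maximum being over the $t$ that are not knots where $\ddot\rho_m$ fails to exist), and let $c_*,c^*$ be real numbers with $\kappa(\rho_m;1)<c_*$. Consider the linear model $\mathbf y=\mathbf X\boldsymbol\beta+\boldsymbol\varepsilon$, $\boldsymbol\varepsilon\sim N(0,\sigma^2\mathbf I_n)$, $\sigma>0$, $n\ge1$, with $\mathbf X=(\mathbf x_1,\dots,\mathbf x_p)\in\mathbb R^{n\times p}$ and $\|\mathbf x_j\|^2/n=1$ for all $j$. Put $A^o=\{j:\beta_j\neq0\}$, $d^o=|A^o|$,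 $\beta_*=\min_{j\in A^o}|\beta_j|$ ($=+\infty$ if $A^o=\emptyset$), and let $\widehat{\boldsymbol\beta}^o$ be the oracle least squares estimator, equal to $(\mathbf X_{A^o}'\mathbf X_{A^o})^{-1}\mathbf X_{A^o}'\mathbf y$ on $A^o$ and to $0$ off $A^o$. The sparse Riesz condition with rank $d^*$ is $$c_*\le\|\mathbf X_A\mathbf b\|^2/n\le c^*\quad\text{for all } A\subseteq\{1,\dots,p\},\ |A|\le d^*,\ \mathbf b\in\mathbb R^A,\ \|\mathbf b\|=1 .\tag{SRC}$$ **PLUS solution.** The KKT conditions at level $\lambda$ are $$\begin{cases}\mathbf x_j'(\mathbf y-\mathbf X\widehat{\boldsymbol\beta})/n=\operatorname{sgn}(\widehat\beta_j)\,\dot\rho(|\widehat\beta_j|;\lambda),&\widehat\beta_j\ne0,\\ |\mathbf x_j'(\mathbf y-\mathbf X\widehat{\boldsymbol\beta})/n|\le\lambda,&\widehat\beta_j=0.\end{cases}\tag{KKT}$$ In the variables $\tau=1/\lambda$, $\mathbf b=\tau\widehat{\boldsymbol\beta}$ they become: $\tau\,\mathbf x_j'\mathbf y/n-\mathbf x_j'\mathbf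 X\mathbf b/n$ equals $\operatorname{sgn}(b_j)\dot\rho_m(|b_j|)$ if $b_j\ne0$, and is at most $1$ in absolute value if $b_j=0$. The main branch, which the PLUS algorithm tracks, is the connected component of $(0,\mathbf 0)$ in the set of all $(\tau,\mathbf b)\in[0,\infty)\times\mathbb R^p$ that satisfy these rescaled conditions. A PLUS solution $\widehat{\boldsymbol\beta}(\lambda)$ is a solution of (KKT) at level $\lambda$ that lies on the main branch, that is, with $(1/\lambda,\widehat{\boldsymbol\beta}/\lambda)$ in it, and that has the fewest nonzero coordinates among all such solutions at this $\lambda$. **Theorem.** There are constants $M_1,M_2>0$ depending only on $c_*,c^*$ and $\rho_m$ such that the following holds. Consider any sequence of such models (in which $n,p,\mathbf X,\boldsymbol\beta,\sigma,d^*$ may all vary) with $p\to\infty$, each satisfying (SRC) with the given $c_*,c^*$ and $$\beta_*\ge M_1\sigma\sqrt{(1+\log p)/n},\qquad M_2d^o+1\le d^*,$$ and put $\lambda=\sigma\sqrt{2(\log p)/n}$. Then the probability that there is exactly one PLUS solution at level $\lambda$ tends to $1$, and every estimator $\widehat{\boldsymbol\beta}$ that equals a PLUS solution at level $\lambda$ whenever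 there is one satisfies, with $\widehat A=\{j:\widehat\beta_j\ne0\}$ and $\operatorname{sgn}$ taken componentwise ($\operatorname{sgn}(0)=0$), $$P\{\widehat A\ne A^o\}\le P\{\widehat{\boldsymbol\beta}\ne\widehat{\boldsymbol\beta}^o\ \text{or}\ \operatorname{sgn}(\widehat{\boldsymbol\beta})\ne\operatorname{sgn}(\boldsymbol\beta)\}\longrightarrow0 .$$ -/

import Mathlib

open MeasureTheory ProbabilityTheory Filter Topology Matrix

noncomputable section

namespace PlusSelection

/-! ### Quadratic spline penalties -/

/-- `ρ` is (on `[0, ∞)`) a quadratic spline with `m` knots, `0` being the first knot: it is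
continuously differentiable and agrees with a polynomial of degree at most two between consecutive
knots and to the right of the last knot. -/
def IsQuadraticSpline (m : ℕ) (ρ : ℝ → ℝ) : Prop :=
  ContDiffOn ℝ 1 ρ (Set.Ici 0) ∧
  ∃ knot : Fin m → ℝ, StrictMono knot ∧ (∃ h : 0 < m, knot ⟨0, h⟩ = 0) ∧
    ∀ i : Fin m, ∃ q : Polynomial ℝ, q.natDegree ≤ 2 ∧
      ∀ t : ℝ, knot i ≤ t → (∀ k : Fin m, i < k → t ≤ knot k) → ρ t = q.eval t

/-- The penalty `ρ(t; lam) = lam² ρₘ(t / lam)`, as a function of `lam` and then `t`. -/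
def penalty (ρm : ℝ → ℝ) (lam t : ℝ) : ℝ := lam ^ 2 * ρm (t / lam)

/-- For some `γ > 0` and all `lam > 0`: the derivative of `ρ(·; lam)` vanishes on `[γ lam, ∞)` and
has right limit `lam` at `0`. -/
def UnbiasedSelection (ρ : ℝ → ℝ → ℝ) : Prop :=
  ∃ γ : ℝ, 0 < γ ∧ ∀ lam : ℝ, 0 < lam →
    (∀ t : ℝ, γ * lam ≤ t → deriv (ρ lam) t = 0) ∧
    Tendsto (deriv (ρ lam)) (𝓝[>] 0) (𝓝 lam)

/-- The maximum concavity: the supremum of minus the second derivative over the `t > 0` at which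
the second derivative exists (for a quadratic spline: all but finitely many `t`; it takes finitely
many values, so the supremum is a maximum). -/
def maxConcavity (ρ : ℝ → ℝ → ℝ) (lam : ℝ) : ℝ :=
  sSup ((fun t => -deriv (deriv (ρ lam)) t) ''
    {t : ℝ | 0 < t ∧ DifferentiableAt ℝ (deriv (ρ lam)) t})

/-! ### The linear model -/

/-- The set of indices of the nonzero coordinates. -/
def supp {p : ℕ} (β : Fin p → ℝ) : Finset (Fin p) := Finset.univ.filter (fun j => β j ≠ 0)

/-- The smallest absolute value of a nonzero coordinate (`⊤` if there is none). -/
def minSignal {p : ℕ} (β : Fin p → ℝ) : WithTop ℝ :=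
  (supp β).inf (fun j => ((|β j| : ℝ) : WithTop ℝ))

/-- The componentwise sign, with `sgn 0 = 0`. -/
def sgn {p : ℕ} (β : Fin p → ℝ) : Fin p → ℝ := fun j => Real.sign (β j)

/-- The law `N(0, σ² I)` on `ℝⁿ`. -/
def noiseLaw (n : ℕ) (σ : ℝ) : Measure (Fin n → ℝ) :=
  Measure.pi (fun _ => gaussianReal 0 (Real.toNNReal (σ ^ 2)))

/-- Every column satisfies `‖x_j‖² / n = 1`. -/
def Standardized {n p : ℕ} (X : Matrix (Fin n) (Fin p) ℝ) : Prop :=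
  ∀ j, (∑ i, X i j ^ 2) / (n : ℝ) = 1

/-- The sparse Riesz condition with rank `dstar` and bounds `clow`, `cup`; a vector `b` indexed
by `A` is written as a vector in `ℝᵖ` that vanishes off `A`. -/
def SparseRiesz {n p : ℕ} (X : Matrix (Fin n) (Fin p) ℝ) (dstar clow cup : ℝ) : Prop :=
  ∀ A : Finset (Fin p), (A.card : ℝ) ≤ dstar →
    ∀ b : Fin p → ℝ, (∀ j, j ∉ A → b j = 0) → ∑ j, b j ^ 2 = 1 →
      clow ≤ (∑ i, (X *ᵥ b) i ^ 2) / (n : ℝ) ∧ (∑ i, (X *ᵥ b) i ^ 2) / (n : ℝ) ≤ cup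

/-- The least squares estimator in the model `A`: `(X_A' X_A)⁻¹ X_A' y` on `A`, zero off `A`. -/
def leastSquares {n p : ℕ} (X : Matrix (Fin n) (Fin p) ℝ) (A : Finset (Fin p))
    (y : Fin n → ℝ) : Fin p → ℝ :=
  let XA : Matrix (Fin n) {j // j ∈ A} ℝ := X.submatrix id Subtype.val
  fun j => if h : j ∈ A then ((XAᵀ * XA)⁻¹ *ᵥ (XAᵀ *ᵥ y)) ⟨j, h⟩ else 0

/-! ### The PLUS solution -/

/-- The Karush–Kuhn–Tucker-type conditions for the penalized squared loss
`‖y - X β‖² / (2 n) + ∑ j, ρ(|β j|; lam)`. -/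
def IsKKT {n p : ℕ} (X : Matrix (Fin n) (Fin p) ℝ) (y : Fin n → ℝ) (ρ : ℝ → ℝ → ℝ) (lam : ℝ)
    (β : Fin p → ℝ) : Prop :=
  ∀ j,
    (β j ≠ 0 → (Xᵀ *ᵥ (y - X *ᵥ β)) j / (n : ℝ) = Real.sign (β j) * deriv (ρ lam) |β j|) ∧
    (β j = 0 → |(Xᵀ *ᵥ (y - X *ᵥ β)) j / (n : ℝ)| ≤ lam)

/-- The rescaled solution set of the KKT conditions for the penalty `penalty ρm`, in the variables
`τ = 1 / lam ≥ 0` and `b = τ β`. With `z* = X' y / n` and `χ_j = X' x_j / n` it consists of the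
`(τ, b)` such that `τ z*_j - χ_j' b = sgn(b_j) ρₘ'(|b_j|)` if `b_j ≠ 0` and
`|τ z*_j - χ_j' b| ≤ 1` if `b_j = 0`. -/
def solutionGraph {n p : ℕ} (X : Matrix (Fin n) (Fin p) ℝ) (y : Fin n → ℝ) (ρm : ℝ → ℝ) :
    Set (ℝ × (Fin p → ℝ)) :=
  {v | 0 ≤ v.1 ∧ ∀ j,
    (v.2 j ≠ 0 → v.1 * ((Xᵀ *ᵥ y) j / (n : ℝ)) - (Xᵀ *ᵥ (X *ᵥ v.2)) j / (n : ℝ)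
      = Real.sign (v.2 j) * deriv ρm |v.2 j|) ∧
    (v.2 j = 0 → |v.1 * ((Xᵀ *ᵥ y) j / (n : ℝ)) - (Xᵀ *ᵥ (X *ᵥ v.2)) j / (n : ℝ)| ≤ 1)}

/-- The main branch, which the PLUS algorithm tracks: the branch (connected component) of the
rescaled solution set that begins at `τ = 0`, `b = 0`. -/
def mainBranch {n p : ℕ} (X : Matrix (Fin n) (Fin p) ℝ) (y : Fin n → ℝ) (ρm : ℝ → ℝ) :
    Set (ℝ × (Fin p → ℝ)) :=
  connectedComponentIn (solutionGraph X y ρm) (0, 0)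

/-- The solutions of the KKT conditions at penalty level `lam` that lie on the main branch. -/
def pathSolutions {n p : ℕ} (X : Matrix (Fin n) (Fin p) ℝ) (y : Fin n → ℝ) (ρm : ℝ → ℝ)
    (lam : ℝ) : Set (Fin p → ℝ) :=
  {β | IsKKT X y (penalty ρm) lam β ∧ (lam⁻¹, lam⁻¹ • β) ∈ mainBranch X y ρm}

/-- A PLUS solution at penalty level `lam`: a sparsest one among the solutions on the main branch
at that level. -/
def IsPlusSolution {n p : ℕ} (X : Matrix (Fin n) (Fin p) ℝ) (y : Fin n → ℝ) (ρm : ℝ → ℝ)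
    (lam : ℝ) (β : Fin p → ℝ) : Prop :=
  β ∈ pathSolutions X y ρm lam ∧
    ∀ β' ∈ pathSolutions X y ρm lam, (supp β).card ≤ (supp β').card

/-- An estimator that returns a PLUS solution at level `lam` for all data for which there is one.
(Where there are several, any rule for choosing one is allowed.) -/
def IsPlusEstimator {n p : ℕ} (X : Matrix (Fin n) (Fin p) ℝ) (ρm : ℝ → ℝ) (lam : ℝ)
    (est : (Fin n → ℝ) → (Fin p → ℝ)) : Prop :=
  ∀ y, (∃ β, IsPlusSolution X y ρm lam β) → IsPlusSolution X y ρm lam (est y)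

/-- The universal penalty level `σ √(2 log p / n)`. -/
def universalLevel (σ : ℝ) (n p : ℕ) : ℝ := σ * √(2 * Real.log p / n)

end PlusSelection

end

open MeasureTheory ProbabilityTheory Filter Topology Matrix

noncomputable section

namespace PlusSelection

/-! ### Quadratic spline penalties -/

/-! Let δ = clow - κ > 0. On vectors supported in a set of at most `dstar` coordinates, the Gram
form has curvature at least clow, while the penalty takes away at most κ. The KKT map restricted to
such a set is therefore strongly monotone (`IsRestrictedSolution.stability`). Restricted solutions
are unique and Lipschitz in τ; they exist as minimizers of the penalized loss.

The main argument is deterministic. Suppose the least squares fit on the true support A has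
coefficients of size at least 2γλ and residual correlations of at most λ (`IsOracleFit`). Any sparse
solution at τλ ≤ 1 lies within squared distance of order |A| of the scaled oracle
(`sum_sq_sub_oracle_le`). While τλ ≤ 1/2, the residual uses up at most half of the threshold 1. A
coordinate outside A can then be active only if its coefficient error or its Gram response is
bounded below, and only O(|A|) coordinates can do that (`card_activeSet_union_le`). Hence sparsity
reproduces itself: a sparse point of the main branch has few active coordinates, so the restricted
solution on them continues the branch to the right (`exists_mem_mainBranch_gt`). Since the levels
with a sparse point on the branch are also closed in [0, 1/(2λ)], they fill this interval.

At τ = 1/(2λ) the sparse point must be the scaled oracle, by uniqueness. From there to τ = 1/λ the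
ray of scaled oracles consists of solutions, because its nonzero coefficients lie where the penalty
is flat (`oracle_mem_mainBranch`). A solution at level λ with no more nonzero coordinates than the
oracle shares a small joint support with it, hence equals it (`isPlusSolution_iff_eq_oracle`).

Probability enters only through the oracle fit. Its error coordinates on A and its residual
correlations off A are linear in the noise, with variances at most σ²/(n clow) and σ²/n. A union
bound over p Gaussian tails at t = √(2 log p) has total mass at most 1/t, which tends to 0, and the
signal strength turns this event into `IsOracleFit` with correct signs
(`isOracleFit_of_mem_goodNoise`). -/

/-- The properties of a penalty, with concavity bounded by `κ` and constant beyond `γ`, on which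
the analysis of the solution path rests. -/
structure IsRegularPenalty (ρ : ℝ → ℝ) (κ γ : ℝ) : Prop where
  contDiffOn : ContDiffOn ℝ 1 ρ (Set.Ici 0)
  pos : 0 < γ
  deriv_eq_zero : ∀ t, γ ≤ t → deriv ρ t = 0
  tendsto_deriv : Tendsto (deriv ρ) (𝓝[>] 0) (𝓝 1)
  deriv_le_add : ∀ s t, 0 < s → s ≤ t → deriv ρ s ≤ deriv ρ t + κ * (t - s)

theorem penalty_one (ρ : ℝ → ℝ) : penalty ρ 1 = ρ := by
  funext t; simp [penalty]

theorem deriv_penalty (ρ : ℝ → ℝ) {lam : ℝ} (hlam : lam ≠ 0) (t : ℝ) :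
    deriv (penalty ρ lam) t = lam * deriv ρ (t / lam) := by
  have h : penalty ρ lam = fun t => lam ^ 2 * ρ (lam⁻¹ * t) := by
    funext t; simp [penalty, div_eq_inv_mul]
  rw [h, deriv_const_mul_field, deriv_comp_mul_left, smul_eq_mul, div_eq_inv_mul]
  field_simp

theorem continuousOn_deriv_Ioi {ρ : ℝ → ℝ} (h : ContDiffOn ℝ 1 ρ (Set.Ici 0)) :
    ContinuousOn (deriv ρ) (Set.Ioi 0) :=
  (h.mono Set.Ioi_subset_Ici_self).continuousOn_deriv_of_isOpen isOpen_Ioi le_rfl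

/-- To the right of every `t ≥ 0` a quadratic spline coincides with one of its pieces. -/
theorem IsQuadraticSpline.exists_eventuallyEq {m : ℕ} {ρ : ℝ → ℝ} (h : IsQuadraticSpline m ρ) :
    ∃ q : Fin m → Polynomial ℝ, (∀ i, (q i).natDegree ≤ 2) ∧
      ∀ t, 0 ≤ t → ∃ i, ∀ᶠ s in 𝓝[≥] t, ρ s = (q i).eval s := by
  obtain ⟨-, knot, hmono, ⟨hm, h0⟩, hq⟩ := h
  choose q hdeg hq using hq
  refine ⟨q, hdeg, fun t ht => ?_⟩
  -- The relevant piece starts at the last knot not exceeding t; the knot 0 guarantees that there is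
  -- one.
  have hne : (Finset.univ.filter fun i => knot i ≤ t).Nonempty := ⟨⟨0, hm⟩, by simp [h0, ht]⟩
  obtain ⟨i, hi, hmax⟩ := (Finset.univ.filter fun i => knot i ≤ t).exists_max_image id hne
  simp only [Finset.mem_filter, Finset.mem_univ, true_and, id] at hi hmax
  refine ⟨i, ?_⟩
  have hev : ∀ᶠ s in 𝓝 t, ∀ k : Fin m, i < k → s ≤ knot k := by
    rw [eventually_all]
    intro k
    by_cases hk : i < k
    · have : t < knot k := by
        by_contra hcon
        exact absurd (hmax k (not_lt.1 hcon)) (not_le.2 hk)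
      filter_upwards [eventually_lt_nhds this] with s hs _ using hs.le
    · exact Eventually.of_forall fun _ hik => absurd hik hk
  filter_upwards [nhdsWithin_le_nhds hev, self_mem_nhdsWithin] with s hs hts
  exact hq i s (hi.trans hts) hs

theorem eval_derivative_derivative_eq {q : Polynomial ℝ} (hq : q.natDegree ≤ 2) (t : ℝ) :
    q.derivative.derivative.eval t = q.coeff 2 * 2 := by
  have h0 : q.derivative.derivative.natDegree = 0 := by
    have h1 := Polynomial.natDegree_derivative_le q
    have h2 := Polynomial.natDegree_derivative_le q.derivative
    omega
  rw [Polynomial.eq_C_of_natDegree_eq_zero h0]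
  simp [Polynomial.coeff_derivative]
  norm_num

theorem eventually_Ioi_eventually_nhds {t : ℝ} {p : ℝ → Prop} (h : ∀ᶠ s in 𝓝[≥] t, p s) :
    ∀ᶠ s in 𝓝[>] t, ∀ᶠ r in 𝓝 s, p r := by
  obtain ⟨u, hu, hsub⟩ := (mem_nhdsGE_iff_exists_Ico_subset).1 h
  filter_upwards [Ioo_mem_nhdsGT hu] with s hs
  filter_upwards [Ioo_mem_nhds hs.1 hs.2] with r hr
  exact hsub ⟨hr.1.le, hr.2⟩

/-- At every point, knots included, the slope has a right derivative, namely the constant second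
derivative of the piece to the right. That value is also a two-sided second derivative at nearby
points, so `maxConcavity` bounds its negative. A mean value inequality for right derivatives then
suffices. -/
theorem IsQuadraticSpline.deriv_le_add {m : ℕ} {ρ : ℝ → ℝ} (h : IsQuadraticSpline m ρ)
    {s t : ℝ} (hs : 0 < s) (hst : s ≤ t) :
    deriv ρ s ≤ deriv ρ t + maxConcavity (penalty ρ) 1 * (t - s) := by
  obtain ⟨q, hdeg, hq⟩ := h.exists_eventuallyEq
  have hcont := continuousOn_deriv_Ioi h.1
  have hderiv : ∀ x, 0 ≤ x → ∃ i, ∀ᶠ r in 𝓝[>] x, ∀ᶠ r' in 𝓝 r,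
      deriv ρ r' = (q i).derivative.eval r' := by
    intro x hx
    obtain ⟨i, hi⟩ := hq x hx
    refine ⟨i, ?_⟩
    filter_upwards [eventually_Ioi_eventually_nhds hi] with r hr
    filter_upwards [hr.eventually_nhds] with r' hr'
    rw [EventuallyEq.deriv_eq hr', Polynomial.deriv]
  have hright : ∀ x, 0 < x → ∃ i, HasDerivWithinAt (deriv ρ) ((q i).coeff 2 * 2) (Set.Ici x) x ∧
      ∃ r, 0 < r ∧ HasDerivAt (deriv ρ) ((q i).coeff 2 * 2) r := by
    intro x hx
    obtain ⟨i, hi⟩ := hderiv x hx.le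
    have hpoly : ∀ r, HasDerivAt (fun r => (q i).derivative.eval r) ((q i).coeff 2 * 2) r := by
      intro r
      simpa [eval_derivative_derivative_eq (hdeg i) r] using (q i).derivative.hasDerivAt r
    have heq : ∀ᶠ r in 𝓝[>] x, deriv ρ r = (q i).derivative.eval r := hi.mono fun r hr => hr.self_of_nhds
    -- Continuity of the slope extends the identity from the open right neighbourhood to x itself.
    have hx' : deriv ρ x = (q i).derivative.eval x := by
      have h1 : Tendsto (deriv ρ) (𝓝[>] x) (𝓝 (deriv ρ x)) :=
        ((hcont x hx).continuousAt (Ioi_mem_nhds hx)).tendsto.mono_left nhdsWithin_le_nhds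
      have h2 : Tendsto (fun r => (q i).derivative.eval r) (𝓝[>] x) (𝓝 ((q i).derivative.eval x)) :=
        ((q i).derivative.continuous.tendsto x).mono_left nhdsWithin_le_nhds
      exact tendsto_nhds_unique (h1.congr' heq) h2
    refine ⟨i, ?_, ?_⟩
    · refine (hpoly x).hasDerivWithinAt.congr_of_eventuallyEq ?_ hx'
      rw [← Set.Ioi_union_left, nhdsWithin_union, nhdsWithin_singleton]
      exact eventually_sup.2 ⟨heq, by simpa using hx'⟩
    · obtain ⟨r, hr, hxr⟩ := (hi.and self_mem_nhdsWithin).exists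
      exact ⟨r, hx.trans hxr, (hpoly r).congr_of_eventuallyEq hr⟩
  -- Finitely many pieces give finitely many values; boundedness matters because `sSup` of an
  -- unbounded set of reals is 0.
  have hbdd : BddAbove ((fun t => -deriv (deriv (penalty ρ 1)) t) ''
      {t : ℝ | 0 < t ∧ DifferentiableAt ℝ (deriv (penalty ρ 1)) t}) := by
    rw [penalty_one]
    refine ((Set.finite_range fun i => -((q i).coeff 2 * 2)).subset ?_).bddAbove
    rintro _ ⟨x, ⟨hx, hd⟩, rfl⟩
    obtain ⟨i, hi, -⟩ := hright x hx
    refine ⟨i, ?_⟩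
    have := (uniqueDiffWithinAt_Ici x).eq_deriv _ hi hd.hasDerivAt.hasDerivWithinAt
    simp [this]
  choose! f' hf' using fun x (hx : 0 < x) =>
    show ∃ a, HasDerivWithinAt (deriv ρ) a (Set.Ici x) x ∧ -a ≤ maxConcavity (penalty ρ) 1 by
      obtain ⟨i, hi, r, hr, hdr⟩ := hright x hx
      refine ⟨_, hi, le_csSup hbdd ⟨r, ⟨hr, ?_⟩, ?_⟩⟩
      · rw [penalty_one]; exact hdr.differentiableAt
      · simp only [penalty_one, hdr.deriv]
  set κ := maxConcavity (penalty ρ) 1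
  have key := image_le_of_deriv_right_le_deriv_boundary (a := s) (b := t)
    (f := fun x => -deriv ρ x) (f' := fun x => -f' x)
    (B := fun x => κ * (x - s) - deriv ρ s) (B' := fun _ => κ)
    (hcont.neg.mono fun x hx => hs.trans_le hx.1)
    (fun x hx => (hf' x (hs.trans_le hx.1)).1.neg) (by simp) (by fun_prop)
    (fun x _ => by
      simpa using ((((hasDerivAt_id x).sub_const s).const_mul κ).sub_const (deriv ρ s)).hasDerivWithinAt)
    (fun x hx => (hf' x (hs.trans_le hx.1)).2) (Set.right_mem_Icc.2 hst)
  linarith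

theorem IsQuadraticSpline.exists_isRegularPenalty {m : ℕ} {ρ : ℝ → ℝ} (h : IsQuadraticSpline m ρ)
    (hρ : UnbiasedSelection (penalty ρ)) :
    ∃ γ, IsRegularPenalty ρ (maxConcavity (penalty ρ) 1) γ := by
  obtain ⟨γ, hγ, hall⟩ := hρ
  have h1 := hall 1 one_pos
  simp only [penalty_one, mul_one] at h1
  exact ⟨γ, h.1, hγ, h1.1, h1.2, fun s t hs hst => h.deriv_le_add hs hst⟩

/-! ### Bounds and continuity for regular penalties -/

namespace IsRegularPenalty

variable {ρ : ℝ → ℝ} {κ γ : ℝ}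

theorem le_deriv (h : IsRegularPenalty ρ κ γ) {t : ℝ} (ht : 0 < t) : 1 - κ * t ≤ deriv ρ t := by
  have h1 : Tendsto (fun s => deriv ρ t + κ * (t - s)) (𝓝[>] 0) (𝓝 (deriv ρ t + κ * (t - 0))) :=
    (Continuous.tendsto (by fun_prop) 0).mono_left nhdsWithin_le_nhds
  have := le_of_tendsto_of_tendsto h.tendsto_deriv h1 (by
    filter_upwards [Ioc_mem_nhdsGT ht] with s hs using h.deriv_le_add s t hs.1 hs.2)
  linarith

/-- The slope must fall from 1 at 0+ to 0 at γ. -/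
theorem concavity_pos (h : IsRegularPenalty ρ κ γ) : 0 < κ := by
  have h1 := h.le_deriv h.pos
  rw [h.deriv_eq_zero γ le_rfl] at h1
  by_contra hκ
  nlinarith [mul_nonneg (neg_nonneg.2 (not_lt.1 hκ)) h.pos.le]

theorem hasDerivAt (h : IsRegularPenalty ρ κ γ) {t : ℝ} (ht : 0 < t) :
    HasDerivAt ρ (deriv ρ t) t :=
  ((h.contDiffOn.differentiableOn one_ne_zero).differentiableAt (Ici_mem_nhds ht)).hasDerivAt

theorem hasDerivWithinAt_zero (h : IsRegularPenalty ρ κ γ) :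
    HasDerivWithinAt ρ 1 (Set.Ici 0) 0 := by
  refine hasDerivWithinAt_Ici_of_tendsto_deriv (s := Set.Ioi 0) ?_ ?_ ?_ h.tendsto_deriv
  · exact fun t ht => (h.hasDerivAt ht).differentiableAt.differentiableWithinAt
  · exact (h.contDiffOn.continuousOn 0 Set.self_mem_Ici).mono Set.Ioi_subset_Ici_self
  · exact self_mem_nhdsWithin

/-- The derivative of the penalty, extended continuously from the right to `0`. -/
theorem continuousOn_update_deriv (h : IsRegularPenalty ρ κ γ) :
    ContinuousOn (Function.update (deriv ρ) 0 1) (Set.Ici 0) := by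
  rw [continuousOn_update_iff]
  have hI : Set.Ici (0 : ℝ) \ {0} = Set.Ioi 0 := by
    ext x; simp [lt_iff_le_and_ne, eq_comm]
  rw [hI]
  exact ⟨continuousOn_deriv_Ioi h.contDiffOn, fun _ => h.tendsto_deriv⟩

theorem exists_abs_deriv_le (h : IsRegularPenalty ρ κ γ) :
    ∃ R, 1 ≤ R ∧ ∀ t, 0 < t → |deriv ρ t| ≤ R := by
  obtain ⟨C, hC⟩ := (isCompact_Icc (a := (0 : ℝ)) (b := γ)).exists_bound_of_continuousOn
    (h.continuousOn_update_deriv.mono Set.Icc_subset_Ici_self)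
  refine ⟨max 1 C, le_max_left _ _, fun t ht => ?_⟩
  rcases le_total t γ with htγ | htγ
  · have := hC t ⟨ht.le, htγ⟩
    rw [Function.update_of_ne ht.ne', Real.norm_eq_abs] at this
    exact this.trans (le_max_right _ _)
  · rw [h.deriv_eq_zero t htγ, abs_zero]
    exact zero_le_one.trans (le_max_left _ _)

theorem eq_of_le (h : IsRegularPenalty ρ κ γ) {t : ℝ} (ht : γ ≤ t) : ρ t = ρ γ := by
  have hd : DifferentiableOn ℝ ρ (Set.Ici γ) := fun x hx =>
    (h.hasDerivAt (h.pos.trans_le hx)).differentiableAt.differentiableWithinAt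
  refine (convex_Ici γ).is_const_of_fderivWithin_eq_zero hd (fun x hx => ?_) ht Set.self_mem_Ici
  have hx' := (h.hasDerivAt (h.pos.trans_le hx))
  rw [h.deriv_eq_zero x hx] at hx'
  have := hx'.hasDerivWithinAt (s := Set.Ici γ)
  rw [hasDerivWithinAt_iff_hasFDerivWithinAt] at this
  rw [this.fderivWithin (uniqueDiffOn_Ici γ x hx)]
  ext; simp

/-- Beyond γ the penalty is constant, so compactness of [0, γ] is enough. This bound makes the
penalized loss coercive where the Gram form is. -/
theorem exists_le (h : IsRegularPenalty ρ κ γ) : ∃ L, ∀ t, L ≤ ρ |t| := by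
  obtain ⟨C, hC⟩ := (isCompact_Icc (a := (0 : ℝ)) (b := γ)).exists_bound_of_continuousOn
    (h.contDiffOn.continuousOn.mono Set.Icc_subset_Ici_self)
  refine ⟨-C, fun t => ?_⟩
  rcases le_total |t| γ with htγ | htγ
  · exact neg_le_of_abs_le (hC _ ⟨abs_nonneg t, htγ⟩)
  · rw [h.eq_of_le htγ]
    exact neg_le_of_abs_le (hC _ ⟨h.pos.le, le_rfl⟩)

theorem continuous_comp_abs (h : IsRegularPenalty ρ κ γ) : Continuous fun t => ρ |t| :=
  h.contDiffOn.continuousOn.comp_continuous continuous_abs fun t => abs_nonneg t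

end IsRegularPenalty

/-! ### Generalized gradients of the penalty -/

/-- `u` is a generalized gradient of `t ↦ ρ |t|` at `t`, where the one-sided slopes at `0` are
`±1`. -/
def IsPenaltyGradient (ρ : ℝ → ℝ) (t u : ℝ) : Prop :=
  (t ≠ 0 → u = Real.sign t * deriv ρ |t|) ∧ (t = 0 → |u| ≤ 1)

namespace IsPenaltyGradient

variable {ρ : ℝ → ℝ} {κ γ t u s v : ℝ}

theorem neg (hu : IsPenaltyGradient ρ t u) : IsPenaltyGradient ρ (-t) (-u) := by
  refine ⟨fun ht => ?_, fun ht => ?_⟩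
  · rw [hu.1 (by simpa using ht), Real.sign_neg, abs_neg, neg_mul]
  · rw [abs_neg]; exact hu.2 (by simpa using ht)

theorem eq_of_pos (hu : IsPenaltyGradient ρ t u) (ht : 0 < t) : u = deriv ρ t := by
  rw [hu.1 ht.ne', Real.sign_of_pos ht, abs_of_pos ht, one_mul]

theorem of_large (h : IsRegularPenalty ρ κ γ) (ht : γ ≤ |t|) : IsPenaltyGradient ρ t 0 := by
  refine ⟨fun _ => by rw [h.deriv_eq_zero _ ht, mul_zero], fun _ => by simp⟩

/-- A small nonzero coefficient forces a score close to the threshold 1, which is how such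
coefficients get counted later. -/
theorem one_sub_le_abs (hu : IsPenaltyGradient ρ t u) (h : IsRegularPenalty ρ κ γ) (ht : t ≠ 0) :
    1 - κ * |t| ≤ |u| := by
  have h1 := h.le_deriv (abs_pos.2 ht)
  have h2 : |u| = |deriv ρ (|t|)| := by
    rw [hu.1 ht, abs_mul]
    rcases Real.sign_apply_eq_of_ne_zero t ht with hs | hs <;> simp [hs]
  exact h1.trans (h2 ▸ le_abs_self _)

theorem abs_le (hu : IsPenaltyGradient ρ t u) {R : ℝ} (hR : 1 ≤ R)
    (hR' : ∀ t, 0 < t → |deriv ρ t| ≤ R) : |u| ≤ R := by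
  by_cases ht : t = 0
  · exact (hu.2 ht).trans hR
  · rw [hu.1 ht, abs_mul]
    rcases Real.sign_apply_eq_of_ne_zero t ht with hs | hs <;> simp [hs, hR' _ (abs_pos.2 ht)]

theorem le_of_pos (hu : IsPenaltyGradient ρ t u) (h : IsRegularPenalty ρ κ γ) (ht : 0 < t) :
    1 - κ * t ≤ u := hu.eq_of_pos ht ▸ h.le_deriv ht

/-- The jump at 0, from -1 to 1, is upward and so only helps; on either side of 0 the slope
decreases at rate at most κ. -/
theorem monotone_of_lt (h : IsRegularPenalty ρ κ γ) (hu : IsPenaltyGradient ρ t u)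
    (hv : IsPenaltyGradient ρ s v) (hst : s < t) : v ≤ u + κ * (t - s) := by
  rcases lt_trichotomy s 0 with hs | rfl | hs
  · rcases lt_trichotomy t 0 with ht | rfl | ht
    · have h1 := h.deriv_le_add (-t) (-s) (by linarith) (by linarith)
      rw [← hu.neg.eq_of_pos (by linarith), ← hv.neg.eq_of_pos (by linarith)] at h1
      linarith
    · have h1 := hv.neg.le_of_pos h (by linarith)
      have h2 := neg_le_of_abs_le (hu.2 rfl)
      linarith
    · have h1 := hv.neg.le_of_pos h (by linarith)
      have h2 := hu.le_of_pos h ht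
      linarith
  · have h1 := hu.le_of_pos h hst
    have h2 := le_of_abs_le (hv.2 rfl)
    linarith
  · have h1 := h.deriv_le_add s t hs hst.le
    rwa [← hu.eq_of_pos (hs.trans hst), ← hv.eq_of_pos hs] at h1

/-- Generalized gradients are monotone up to the concavity of the penalty. -/
theorem mul_sub_le (h : IsRegularPenalty ρ κ γ) (hu : IsPenaltyGradient ρ t u)
    (hv : IsPenaltyGradient ρ s v) : -(κ * (t - s) ^ 2) ≤ (t - s) * (u - v) := by
  rcases lt_trichotomy s t with hst | rfl | hst
  · nlinarith [monotone_of_lt h hu hv hst]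
  · simp
  · nlinarith [monotone_of_lt h hv hu hst]

/-- The delicate point is t = 0: the limits 1 and -1 of the two branches are the endpoints of the
vertical segment [-1, 1], so each branch can be closed up without leaving the set. -/
theorem isClosed (h : IsRegularPenalty ρ κ γ) :
    IsClosed {x : ℝ × ℝ | IsPenaltyGradient ρ x.1 x.2} := by
  set D := Function.update (deriv ρ) 0 1
  have hD : Continuous fun t => D |t| :=
    h.continuousOn_update_deriv.comp_continuous continuous_abs fun t => abs_nonneg t
  have heq : {x : ℝ × ℝ | IsPenaltyGradient ρ x.1 x.2} =
      ({x | 0 ≤ x.1 ∧ x.2 = D |x.1|} ∪ {x | x.1 ≤ 0 ∧ x.2 = -D |x.1|}) ∪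
        {x | x.1 = 0 ∧ |x.2| ≤ 1} := by
    ext ⟨t, u⟩
    simp only [Set.mem_ofPred_eq, Set.mem_union]
    rcases lt_trichotomy t 0 with ht | rfl | ht
    · have : D |t| = deriv ρ |t| := Function.update_of_ne (abs_pos.2 ht.ne).ne' _ _
      simp [IsPenaltyGradient, this, ht.ne, ht.le, ht.not_ge, Real.sign_of_neg ht]
    · have : D 0 = 1 := Function.update_self _ _ _
      simp only [IsPenaltyGradient, ne_eq, not_true_eq_false, false_imp_iff, true_imp_iff, true_and,
        abs_zero, this, le_refl]
      constructor
      · exact Or.inr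
      · rintro ((rfl | rfl) | hu) <;> simp_all
    · have : D |t| = deriv ρ |t| := Function.update_of_ne (abs_pos.2 ht.ne').ne' _ _
      simp [IsPenaltyGradient, this, ht.ne', ht.le, ht.not_ge, Real.sign_of_pos ht]
  rw [heq]
  have hD' : Continuous fun x : ℝ × ℝ => D |x.1| := hD.comp continuous_fst
  refine (IsClosed.union ?_ ?_).union ?_
  · exact (isClosed_le continuous_const continuous_fst).inter (isClosed_eq continuous_snd hD')
  · exact (isClosed_le continuous_fst continuous_const).inter (isClosed_eq continuous_snd hD'.neg)
  · exact (isClosed_eq continuous_fst continuous_const).inter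
      (isClosed_le continuous_snd.abs continuous_const)

theorem le_one_of_isMin (h : IsRegularPenalty ρ κ γ) {a : ℝ}
    (hmin : ∀ r, 0 < r → ρ 0 ≤ a * r ^ 2 - u * r + ρ r) : u ≤ 1 := by
  have h1 : Tendsto (slope ρ 0) (𝓝[>] 0) (𝓝 1) := by
    have := h.hasDerivWithinAt_zero.Ioi_of_Ici
    rwa [hasDerivWithinAt_iff_tendsto_slope' (by simp)] at this
  have h2 : Tendsto (fun r => u - a * r) (𝓝[>] 0) (𝓝 (u - a * 0)) :=
    (Continuous.tendsto (by fun_prop) 0).mono_left nhdsWithin_le_nhds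
  rw [mul_zero, sub_zero] at h2
  refine le_of_tendsto_of_tendsto h2 h1 ?_
  filter_upwards [self_mem_nhdsWithin] with r (hr : 0 < r)
  rw [slope_def_field, sub_zero, le_div_iff₀ hr]
  nlinarith [hmin r hr]

theorem eq_deriv_of_isMin (h : IsRegularPenalty ρ κ γ) {a : ℝ} (ht : 0 < t)
    (hmin : ∀ r, ρ |t| ≤ a * r ^ 2 - u * r + ρ |t + r|) : u = deriv ρ t := by
  have hd : HasDerivAt (fun r => a * r ^ 2 - u * r + ρ (t + r)) (deriv ρ t - u) 0 := by
    have h1 : HasDerivAt (fun r => ρ (t + r)) (deriv ρ t) 0 := by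
      have := h.hasDerivAt ht
      rw [← add_zero t] at this
      simpa using this.comp_const_add t 0
    have h2 := ((((hasDerivAt_id (0 : ℝ)).pow 2).const_mul a).sub
      ((hasDerivAt_id (0 : ℝ)).const_mul u)).add h1
    exact h2.congr_deriv (by simp [sub_eq_neg_add])
  have hloc : IsLocalMin (fun r => a * r ^ 2 - u * r + ρ (t + r)) 0 := by
    filter_upwards [Ioi_mem_nhds (show -t < 0 by linarith)] with r (hr : -t < r)
    have := hmin r
    rw [abs_of_pos ht, abs_of_pos (show 0 < t + r by linarith)] at this
    simpa using this
  linarith [hloc.hasDerivAt_eq_zero hd]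

/-- First order condition: at a minimum of a quadratic with slope `-u` plus `ρ |·|`, the number `u`
is a generalized gradient. -/
theorem of_isMin (h : IsRegularPenalty ρ κ γ) {a : ℝ}
    (hmin : ∀ r, ρ |t| ≤ a * r ^ 2 - u * r + ρ |t + r|) : IsPenaltyGradient ρ t u := by
  have hmin' : ∀ r, ρ |-t| ≤ a * r ^ 2 - (-u) * r + ρ |-t + r| := fun r => by
    have := hmin (-r)
    rw [show t + -r = -(-t + r) by ring, abs_neg] at this
    rw [abs_neg]
    linarith [this, neg_sq r, show a * (-r) ^ 2 = a * r ^ 2 by ring]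
  refine ⟨fun ht => ?_, ?_⟩
  · rcases lt_or_gt_of_ne ht with ht | ht
    · rw [Real.sign_of_neg ht, abs_of_neg ht, ← eq_deriv_of_isMin h (neg_pos.2 ht) hmin']
      ring
    · rw [Real.sign_of_pos ht, abs_of_pos ht, one_mul]
      exact eq_deriv_of_isMin h ht hmin
  · rintro rfl
    refine _root_.abs_le.2 ⟨?_, ?_⟩
    · have := le_one_of_isMin h (u := -u) (a := a) fun r hr => by
        simpa [abs_of_pos hr] using hmin' r
      linarith
    · exact le_one_of_isMin h (a := a) fun r hr => by simpa [abs_of_pos hr] using hmin r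

end IsPenaltyGradient

/-! ### The quadratic loss -/

section Loss

variable {n p : ℕ} (X : Matrix (Fin n) (Fin p) ℝ)

/-- The quadratic form `‖X b‖² / n`. -/
def gramForm (b : Fin p → ℝ) : ℝ := (∑ i, (X *ᵥ b) i ^ 2) / (n : ℝ)

/-- The rescaled score `τ X' y / n - X' X b / n`. -/
def score (y : Fin n → ℝ) (τ : ℝ) (b : Fin p → ℝ) (j : Fin p) : ℝ :=
  τ * ((Xᵀ *ᵥ y) j / (n : ℝ)) - (Xᵀ *ᵥ (X *ᵥ b)) j / (n : ℝ)

theorem mem_solutionGraph {y : Fin n → ℝ} {ρ : ℝ → ℝ} {τ : ℝ} {b : Fin p → ℝ} :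
    (τ, b) ∈ solutionGraph X y ρ ↔
      0 ≤ τ ∧ ∀ j, IsPenaltyGradient ρ (b j) (score X y τ b j) := Iff.rfl

theorem sum_mul_transpose_mulVec (w : Fin p → ℝ) (v : Fin n → ℝ) :
    ∑ j, w j * ((Xᵀ *ᵥ v) j / (n : ℝ)) = (∑ i, (X *ᵥ w) i * v i) / (n : ℝ) := by
  have h : w ⬝ᵥ (Xᵀ *ᵥ v) = (X *ᵥ w) ⬝ᵥ v := by
    rw [dotProduct_mulVec, vecMul_transpose]
  simp only [dotProduct] at h
  rw [← h, Finset.sum_div]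
  simp only [mul_div_assoc]

theorem sum_mul_gram (b : Fin p → ℝ) :
    ∑ j, b j * ((Xᵀ *ᵥ (X *ᵥ b)) j / (n : ℝ)) = gramForm X b := by
  rw [sum_mul_transpose_mulVec, gramForm]
  simp only [sq]

theorem gramForm_add (b w : Fin p → ℝ) :
    gramForm X (b + w) =
      gramForm X b + 2 * ∑ j, w j * ((Xᵀ *ᵥ (X *ᵥ b)) j / (n : ℝ)) + gramForm X w := by
  rw [sum_mul_transpose_mulVec]
  simp only [gramForm, mulVec_add, Pi.add_apply]
  rw [← mul_div_assoc, ← add_div, ← add_div, Finset.mul_sum, ← Finset.sum_add_distrib,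
    ← Finset.sum_add_distrib]
  congr 1
  exact Finset.sum_congr rfl fun i _ => by ring

theorem gramForm_smul (r : ℝ) (b : Fin p → ℝ) : gramForm X (r • b) = r ^ 2 * gramForm X b := by
  simp only [gramForm, mulVec_smul, Pi.smul_apply, smul_eq_mul, mul_pow, ← Finset.mul_sum,
    mul_div_assoc]

theorem gramForm_nonneg (b : Fin p → ℝ) : 0 ≤ gramForm X b :=
  div_nonneg (Finset.sum_nonneg fun _ _ => sq_nonneg _) (Nat.cast_nonneg _)

theorem continuous_gramForm : Continuous (gramForm X) := by
  unfold gramForm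
  fun_prop

theorem score_sub_score (y : Fin n → ℝ) (τ τ' : ℝ) (b b' : Fin p → ℝ) (j : Fin p) :
    score X y τ b j - score X y τ' b' j =
      (τ - τ') * ((Xᵀ *ᵥ y) j / (n : ℝ)) - (Xᵀ *ᵥ (X *ᵥ (b - b'))) j / (n : ℝ) := by
  simp only [score, mulVec_sub, Pi.sub_apply]
  ring

/-- Expands the score around the scaled vector τβ, separating the residual at β from the Gram
response to the deviation. -/
theorem score_eq_residual (y : Fin n → ℝ) (τ : ℝ) (b β : Fin p → ℝ) (j : Fin p) :
    score X y τ b j = τ * ((Xᵀ *ᵥ (y - X *ᵥ β)) j / (n : ℝ)) -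
      (Xᵀ *ᵥ (X *ᵥ (b - τ • β))) j / (n : ℝ) := by
  simp only [score, mulVec_sub, mulVec_smul, Pi.sub_apply, Pi.smul_apply, smul_eq_mul]
  ring

theorem continuous_score (y : Fin n → ℝ) (j : Fin p) :
    Continuous fun v : ℝ × (Fin p → ℝ) => score X y v.1 v.2 j := by
  unfold score
  fun_prop

variable {X}

theorem SparseRiesz.gramForm_bounds {dstar clow cup : ℝ} (h : SparseRiesz X dstar clow cup)
    {A : Finset (Fin p)} (hA : (A.card : ℝ) ≤ dstar) {b : Fin p → ℝ} (hb : ∀ j, j ∉ A → b j = 0) :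
    clow * ∑ j, b j ^ 2 ≤ gramForm X b ∧ gramForm X b ≤ cup * ∑ j, b j ^ 2 := by
  rcases (Finset.sum_nonneg fun j (_ : j ∈ Finset.univ) => sq_nonneg (b j)).eq_or_lt with h0 | h0
  · have : b = 0 := by
      funext j
      have := (Finset.sum_eq_zero_iff_of_nonneg fun j _ => sq_nonneg (b j)).1 h0.symm j
        (Finset.mem_univ j)
      simpa using this
    subst this
    simp [gramForm]
  · set S := ∑ j, b j ^ 2
    have hs : 0 < √S := Real.sqrt_pos.2 h0
    have hsq : √S ^ 2 = S := Real.sq_sqrt h0.le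
    have h1 := h A hA ((√S)⁻¹ • b) (fun j hj => by simp [hb j hj]) (by
      simp only [Pi.smul_apply, smul_eq_mul, mul_pow, ← Finset.mul_sum, inv_pow, hsq]
      exact inv_mul_cancel₀ h0.ne')
    change clow ≤ gramForm X _ ∧ gramForm X _ ≤ cup at h1
    rw [gramForm_smul, inv_pow, hsq, inv_mul_eq_div, le_div_iff₀ h0, div_le_iff₀ h0] at h1
    exact h1

theorem SparseRiesz.clow_le_cup {dstar clow cup : ℝ} (h : SparseRiesz X dstar clow cup)
    (hd : 1 ≤ dstar) (j : Fin p) : clow ≤ cup := by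
  have h1 := h {j} (by simpa using hd) (Pi.single j 1)
    (fun k hk => Pi.single_eq_of_ne (by simpa using hk) _) (by simp [Pi.single_apply])
  exact h1.1.trans h1.2

/-- Restricted to few coordinates, `X'` is bounded. -/
theorem SparseRiesz.sum_sq_transpose_le {dstar clow cup : ℝ} (h : SparseRiesz X dstar clow cup)
    (hcup : 0 ≤ cup) {S : Finset (Fin p)} (hS : (S.card : ℝ) ≤ dstar) (b : Fin p → ℝ) :
    ∑ j ∈ S, ((Xᵀ *ᵥ (X *ᵥ b)) j / (n : ℝ)) ^ 2 ≤ cup * gramForm X b := by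
  set g : Fin p → ℝ := fun j => (Xᵀ *ᵥ (X *ᵥ b)) j / (n : ℝ) with hg
  -- Duality: testing X'Xb/n against its own truncation to S gives the sum of squares, and
  -- Cauchy–Schwarz bounds this by the Gram forms of w and b, where w is supported on few
  -- coordinates.
  set w : Fin p → ℝ := fun j => if j ∈ S then g j else 0 with hw
  have h1 : ∑ j, w j ^ 2 = ∑ j ∈ S, g j ^ 2 := by
    simp [hw, ite_pow, Finset.sum_ite_mem]
  have h2 : ∑ j, w j * g j = ∑ j ∈ S, g j ^ 2 := by
    simp [hw, ite_mul, Finset.sum_ite_mem, sq]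
  have h3 : ∑ j, w j * g j = (∑ i, (X *ᵥ w) i * (X *ᵥ b) i) / (n : ℝ) :=
    sum_mul_transpose_mulVec X w _
  have h4 := (h.gramForm_bounds hS (b := w) fun j hj => by simp [hw, hj]).2
  have h5 : ((∑ i, (X *ᵥ w) i * (X *ᵥ b) i) / (n : ℝ)) ^ 2 ≤ gramForm X w * gramForm X b := by
    unfold gramForm
    rw [div_pow, div_mul_div_comm, ← sq]
    exact div_le_div_of_nonneg_right (Finset.sum_mul_sq_le_sq_mul_sq _ _ _) (sq_nonneg _)
  rw [← h3, h2] at h5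
  rw [h1] at h4
  have h6 := gramForm_nonneg X b
  rcases (Finset.sum_nonneg fun j (_ : j ∈ S) => sq_nonneg (g j)).eq_or_lt with h0 | h0
  · rw [← h0]
    exact mul_nonneg hcup h6
  · nlinarith [mul_le_mul_of_nonneg_right h4 h6]

end Loss

/-! ### Solutions restricted to a sparse set of coordinates -/

section Restricted

variable {n p : ℕ} {X : Matrix (Fin n) (Fin p) ℝ} {y : Fin n → ℝ} {ρ : ℝ → ℝ}
  {κ γ dstar clow cup : ℝ} {B : Finset (Fin p)}

/-- `b` vanishes off `B` and solves the rescaled conditions for the coordinates in `B`. -/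
def IsRestrictedSolution (X : Matrix (Fin n) (Fin p) ℝ) (y : Fin n → ℝ) (ρ : ℝ → ℝ)
    (B : Finset (Fin p)) (τ : ℝ) (b : Fin p → ℝ) : Prop :=
  (∀ j, j ∉ B → b j = 0) ∧ ∀ j ∈ B, IsPenaltyGradient ρ (b j) (score X y τ b j)

/-- Pair the difference of the two score equations with b - b'. The Gram term contributes at least
clow times the squared distance, and the gradients cost at most κ times it. -/
theorem IsRestrictedSolution.stability (h : IsRegularPenalty ρ κ γ)
    (hX : SparseRiesz X dstar clow cup) (hB : (B.card : ℝ) ≤ dstar) {τ τ' : ℝ} {b b' : Fin p → ℝ}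
    (hb : IsRestrictedSolution X y ρ B τ b) (hb' : IsRestrictedSolution X y ρ B τ' b') :
    (clow - κ) * ∑ j, (b j - b' j) ^ 2 ≤
      (τ - τ') * ∑ j, (b j - b' j) * ((Xᵀ *ᵥ y) j / (n : ℝ)) := by
  have h1 := (hX.gramForm_bounds hB (b := b - b') fun j hj => by
    simp [hb.1 j hj, hb'.1 j hj]).1
  rw [← sum_mul_gram] at h1
  have h2 : ∀ j, (b - b') j * ((Xᵀ *ᵥ (X *ᵥ (b - b'))) j / (n : ℝ)) ≤
      (τ - τ') * ((b j - b' j) * ((Xᵀ *ᵥ y) j / (n : ℝ))) + κ * (b j - b' j) ^ 2 := by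
    intro j
    by_cases hj : j ∈ B
    · have h3 := IsPenaltyGradient.mul_sub_le h (hb.2 j hj) (hb'.2 j hj)
      rw [score_sub_score] at h3
      simp only [Pi.sub_apply]
      linarith
    · simp [hb.1 j hj, hb'.1 j hj]
  have h3 := Finset.sum_le_sum fun j (_ : j ∈ Finset.univ) => h2 j
  rw [Finset.sum_add_distrib, ← Finset.mul_sum, ← Finset.mul_sum] at h3
  simp only [Pi.sub_apply] at h1 h3
  linarith

theorem IsRestrictedSolution.unique (h : IsRegularPenalty ρ κ γ)
    (hX : SparseRiesz X dstar clow cup) (hκ : κ < clow) (hB : (B.card : ℝ) ≤ dstar) {τ : ℝ}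
    {b b' : Fin p → ℝ} (hb : IsRestrictedSolution X y ρ B τ b)
    (hb' : IsRestrictedSolution X y ρ B τ b') : b = b' := by
  have h1 := hb.stability h hX hB hb'
  rw [sub_self, zero_mul] at h1
  have h2 : ∑ j, (b j - b' j) ^ 2 = 0 :=
    le_antisymm (nonpos_of_mul_nonpos_right h1 (sub_pos.2 hκ))
      (Finset.sum_nonneg fun _ _ => sq_nonneg _)
  funext j
  have := (Finset.sum_eq_zero_iff_of_nonneg fun j _ => sq_nonneg (b j - b' j)).1 h2 j
    (Finset.mem_univ j)
  exact sub_eq_zero.1 (pow_eq_zero_iff two_ne_zero |>.1 this)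

theorem IsRestrictedSolution.abs_sub_le (h : IsRegularPenalty ρ κ γ)
    (hX : SparseRiesz X dstar clow cup) (hκ : κ < clow) (hB : (B.card : ℝ) ≤ dstar) {τ τ' : ℝ}
    {b b' : Fin p → ℝ} (hb : IsRestrictedSolution X y ρ B τ b)
    (hb' : IsRestrictedSolution X y ρ B τ' b') (j : Fin p) :
    |b j - b' j| ≤ √(∑ j, ((Xᵀ *ᵥ y) j / (n : ℝ)) ^ 2) / (clow - κ) * |τ - τ'| := by
  have hδ := sub_pos.2 hκ
  have h1 := hb.stability h hX hB hb'
  set S := ∑ j, (b j - b' j) ^ 2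
  set Z := ∑ j, ((Xᵀ *ᵥ y) j / (n : ℝ)) ^ 2
  have hS : 0 ≤ S := Finset.sum_nonneg fun _ _ => sq_nonneg _
  have h2 : ∑ j, (b j - b' j) * ((Xᵀ *ᵥ y) j / (n : ℝ)) ≤ √S * √Z :=
    Real.sum_mul_le_sqrt_mul_sqrt _ _ _
  have h2' : -(√S * √Z) ≤ ∑ j, (b j - b' j) * ((Xᵀ *ᵥ y) j / (n : ℝ)) := by
    have := Real.sum_mul_le_sqrt_mul_sqrt Finset.univ (fun j => -(b j - b' j))
      fun j => (Xᵀ *ᵥ y) j / (n : ℝ)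
    simp only [neg_mul, Finset.sum_neg_distrib, neg_sq] at this
    linarith
  have h3 : (clow - κ) * S ≤ |τ - τ'| * (√S * √Z) := by
    refine h1.trans ((le_abs_self _).trans ?_)
    rw [abs_mul]
    exact mul_le_mul_of_nonneg_left (abs_le.2 ⟨h2', h2⟩) (abs_nonneg _)
  have h4 : |b j - b' j| ≤ √S := by
    rw [← Real.sqrt_sq_eq_abs]
    exact Real.sqrt_le_sqrt (Finset.single_le_sum (f := fun j => (b j - b' j) ^ 2)
      (fun _ _ => sq_nonneg _) (Finset.mem_univ j))
  refine h4.trans ?_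
  rw [div_mul_eq_mul_div, le_div_iff₀ hδ]
  rcases (Real.sqrt_nonneg S).eq_or_lt with h0 | h0
  · rw [← h0]; simp; positivity
  · have : √S * ((√S) * (clow - κ)) ≤ √S * (√Z * |τ - τ'|) := by
      nlinarith [Real.mul_self_sqrt hS]
    exact le_of_mul_le_mul_left this h0

theorem isClosed_vanishing (B : Finset (Fin p)) :
    IsClosed {b : Fin p → ℝ | ∀ j, j ∉ B → b j = 0} := by
  have : {b : Fin p → ℝ | ∀ j, j ∉ B → b j = 0} = ⋂ j, ⋂ (_ : j ∉ B), {b | b j = 0} := by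
    ext; simp
  rw [this]
  exact isClosed_iInter fun j => isClosed_iInter fun _ =>
    isClosed_eq (continuous_apply j) continuous_const

/-- Minimize half the Gram form minus the linear term plus the penalty over vectors vanishing off B.
Varying one coordinate of B at a time yields the gradient conditions. -/
theorem exists_isRestrictedSolution (h : IsRegularPenalty ρ κ γ)
    (hX : SparseRiesz X dstar clow cup) (hclow : 0 < clow) (hB : (B.card : ℝ) ≤ dstar) (τ : ℝ) :
    ∃ b, IsRestrictedSolution X y ρ B τ b := by
  obtain ⟨L, hL⟩ := h.exists_le
  set z : Fin p → ℝ := fun j => (Xᵀ *ᵥ y) j / (n : ℝ)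
  set F : (Fin p → ℝ) → ℝ := fun b => gramForm X b / 2 - τ * ∑ j, b j * z j + ∑ j, ρ |b j|
  have hF : Continuous F := by
    have h1 := continuous_gramForm X
    have h2 : Continuous fun b : Fin p → ℝ => ∑ j, ρ |b j| :=
      continuous_finsetSum _ fun j _ => h.continuous_comp_abs.comp (continuous_apply j)
    fun_prop
  set s : Set (Fin p → ℝ) := {b | (∀ j, j ∉ B → b j = 0) ∧ F b ≤ F 0}
  have hclosed : IsClosed s := by
    exact (isClosed_vanishing B).inter (isClosed_le hF continuous_const)
  set C := F 0 + τ ^ 2 / clow * ∑ j, z j ^ 2 - ∑ _j : Fin p, L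
  have hbound : ∀ b ∈ s, clow / 4 * ∑ j, b j ^ 2 ≤ C := by
    rintro b ⟨hb, hbF⟩
    have h1 := (hX.gramForm_bounds hB hb).1
    -- Young's inequality, weighted so that clow/4 of the curvature clow/2 survives.
    have h2 : ∀ j, τ * (b j * z j) ≤ clow / 4 * b j ^ 2 + τ ^ 2 / clow * z j ^ 2 := by
      intro j
      have : 0 ≤ (clow / 2 * b j - τ * z j) ^ 2 / clow := by positivity
      have e : (clow / 2 * b j - τ * z j) ^ 2 / clow =
        clow / 4 * b j ^ 2 + τ ^ 2 / clow * z j ^ 2 - τ * (b j * z j) := by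
        field_simp; ring
      linarith
    have h3 := Finset.sum_le_sum fun j (_ : j ∈ Finset.univ) => h2 j
    rw [Finset.sum_add_distrib, ← Finset.mul_sum, ← Finset.mul_sum, ← Finset.mul_sum] at h3
    have h4 : ∑ _j : Fin p, L ≤ ∑ j, ρ |b j| := Finset.sum_le_sum fun j _ => hL _
    simp only [F] at hbF
    simp only [C, F]
    linarith
  have hcompact : IsCompact s := by
    refine (isCompact_Icc (a := fun _ : Fin p => -√(C / (clow / 4)))
      (b := fun _ => √(C / (clow / 4)))).of_isClosed_subset hclosed fun b hb => ?_
    have : ∀ j, |b j| ≤ √(C / (clow / 4)) := fun j => by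
      rw [← Real.sqrt_sq_eq_abs]
      refine Real.sqrt_le_sqrt ((le_div_iff₀' (by positivity)).2 (le_trans ?_ (hbound b hb)))
      exact mul_le_mul_of_nonneg_left (Finset.single_le_sum (f := fun j => b j ^ 2)
        (fun _ _ => sq_nonneg _) (Finset.mem_univ j)) (by positivity)
    exact ⟨fun j => (abs_le.1 (this j)).1, fun j => (abs_le.1 (this j)).2⟩
  obtain ⟨b, hb, hmin⟩ := hcompact.exists_isMinOn ⟨0, by simp [s]⟩ hF.continuousOn
  have hmin' : ∀ b', (∀ j, j ∉ B → b' j = 0) → F b ≤ F b' := fun b' hb' => by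
    rcases le_total (F b') (F 0) with h0 | h0
    · exact hmin ⟨hb', h0⟩
    · exact hb.2.trans h0
  -- Moving by r in direction j changes the quadratic part of the loss by exactly a r² minus r times
  -- the score.
  refine ⟨b, hb.1, fun j hj => IsPenaltyGradient.of_isMin h
    (a := gramForm X (Pi.single j 1) / 2) fun r => ?_⟩
  have h1 := hmin' (b + Pi.single j r) fun k hk => by
    have hne : k ≠ j := fun e => hk (e ▸ hj)
    simp [hb.1 k hk, hne]
  have h2 : (Pi.single j r : Fin p → ℝ) = r • Pi.single j 1 := by
    rw [← Pi.single_smul]; simp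
  have h3 : ∀ w : Fin p → ℝ, ∑ k, (Pi.single j r : Fin p → ℝ) k * w k = r * w j := fun w => by
    simp [Pi.single_apply, ite_mul]
  have h4 : ∑ k, ρ |(b + Pi.single j r : Fin p → ℝ) k| - ∑ k, ρ |b k| = ρ |b j + r| - ρ |b j| := by
    rw [← Finset.sum_sub_distrib, Finset.sum_eq_single j]
    · simp
    · intro k _ hk; simp [hk]
    · simp
  have h5 : ∑ k, (b + Pi.single j r : Fin p → ℝ) k * z k = ∑ k, b k * z k + r * z j := by
    simp only [Pi.add_apply, add_mul, Finset.sum_add_distrib, h3]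
  simp only [F] at h1
  rw [gramForm_add, h5] at h1
  rw [h3 fun j => (Xᵀ *ᵥ (X *ᵥ b)) j / (n : ℝ)] at h1
  rw [h2, gramForm_smul, ← h2] at h1
  simp only [score]
  change _ ≤ _ - (τ * z j - _) * r + _
  linarith

end Restricted

/-! ### Topology of the solution graph -/

section Graph

variable {n p : ℕ} {X : Matrix (Fin n) (Fin p) ℝ} {y : Fin n → ℝ} {ρ : ℝ → ℝ} {κ γ : ℝ}

theorem isClosed_solutionGraph (h : IsRegularPenalty ρ κ γ) : IsClosed (solutionGraph X y ρ) := by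
  have heq : solutionGraph X y ρ = {v | 0 ≤ v.1} ∩
      ⋂ j, (fun v : ℝ × (Fin p → ℝ) => (v.2 j, score X y v.1 v.2 j)) ⁻¹'
        {x | IsPenaltyGradient ρ x.1 x.2} := by
    ext ⟨τ, b⟩
    simp [mem_solutionGraph]
  rw [heq]
  refine (isClosed_le continuous_const continuous_fst).inter (isClosed_iInter fun j => ?_)
  exact (IsPenaltyGradient.isClosed h).preimage
    (((continuous_apply j).comp continuous_snd).prodMk (continuous_score X y j))

theorem zero_mem_solutionGraph : ((0 : ℝ), (0 : Fin p → ℝ)) ∈ solutionGraph X y ρ :=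
  ⟨le_rfl, fun j => ⟨fun hj => absurd rfl hj, fun _ => by simp⟩⟩

theorem zero_mem_mainBranch : ((0 : ℝ), (0 : Fin p → ℝ)) ∈ mainBranch X y ρ :=
  mem_connectedComponentIn zero_mem_solutionGraph

theorem mainBranch_subset : mainBranch X y ρ ⊆ solutionGraph X y ρ :=
  connectedComponentIn_subset _ _

theorem isClosed_mainBranch (h : IsRegularPenalty ρ κ γ) : IsClosed (mainBranch X y ρ) := by
  rw [mainBranch, connectedComponentIn_eq_image zero_mem_solutionGraph]
  exact (isClosed_solutionGraph h).isClosedEmbedding_subtypeVal.isClosedMap _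
    isClosed_connectedComponent

theorem mem_mainBranch_of_path {f : ℝ → ℝ × (Fin p → ℝ)} {a c : ℝ} (hac : a ≤ c)
    (hf : ContinuousOn f (Set.Icc a c)) (hmem : ∀ t ∈ Set.Icc a c, f t ∈ solutionGraph X y ρ)
    (ha : f a ∈ mainBranch X y ρ) : f c ∈ mainBranch X y ρ := by
  have h1 := (isPreconnected_Icc.image f hf).subset_connectedComponentIn (F := solutionGraph X y ρ)
    (Set.mem_image_of_mem f (Set.left_mem_Icc.2 hac)) (Set.image_subset_iff.2 fun t ht => hmem t ht)
  rw [mainBranch, connectedComponentIn_eq ha]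
  exact h1 (Set.mem_image_of_mem f (Set.right_mem_Icc.2 hac))

theorem isKKT_iff {lam : ℝ} (hlam : 0 < lam) (β : Fin p → ℝ) :
    IsKKT X y (penalty ρ) lam β ↔ (lam⁻¹, lam⁻¹ • β) ∈ solutionGraph X y ρ := by
  have hinv := inv_pos.2 hlam
  rw [mem_solutionGraph, and_iff_right hinv.le]
  refine forall_congr' fun j => ?_
  have h1 : score X y lam⁻¹ (lam⁻¹ • β) j = (Xᵀ *ᵥ (y - X *ᵥ β)) j / (n : ℝ) / lam := by
    simp only [score, mulVec_sub, mulVec_smul, Pi.sub_apply, Pi.smul_apply, smul_eq_mul]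
    ring
  have h2 : Real.sign (lam⁻¹ * β j) = Real.sign (β j) := by
    rcases lt_trichotomy (β j) 0 with hb | hb | hb
    · rw [Real.sign_of_neg hb, Real.sign_of_neg (mul_neg_of_pos_of_neg hinv hb)]
    · simp [hb]
    · rw [Real.sign_of_pos hb, Real.sign_of_pos (mul_pos hinv hb)]
  have h3 : |lam⁻¹ * β j| = |β j| / lam := by
    rw [abs_mul, abs_of_pos hinv, inv_mul_eq_div]
  simp only [IsPenaltyGradient, h1, Pi.smul_apply, smul_eq_mul, h2, h3, deriv_penalty ρ hlam.ne',
    ne_eq, mul_eq_zero, hinv.ne', false_or]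
  rw [div_eq_iff hlam.ne', abs_div _ lam, abs_of_pos hlam, div_le_one hlam]
  simp only [mul_assoc, mul_comm lam]

/-- The set is a finite union of coordinate subspaces. -/
theorem isClosed_sparse (A : Finset (Fin p)) (d : ℝ) :
    IsClosed {b : Fin p → ℝ | ((supp b ∪ A).card : ℝ) ≤ d} := by
  have heq : {b : Fin p → ℝ | ((supp b ∪ A).card : ℝ) ≤ d} =
      ⋃ B ∈ {B : Finset (Fin p) | A ⊆ B ∧ (B.card : ℝ) ≤ d}, {b | ∀ j, j ∉ B → b j = 0} := by
    ext b
    simp only [Set.mem_ofPred_eq, Set.mem_iUnion, exists_prop]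
    constructor
    · intro hb
      refine ⟨_, ⟨Finset.subset_union_right, hb⟩, fun j hj => ?_⟩
      simp only [supp, Finset.mem_union, Finset.mem_filter, Finset.mem_univ, true_and,
        not_or, not_not] at hj
      exact hj.1
    · rintro ⟨B, ⟨hAB, hBd⟩, hb⟩
      refine le_trans (Nat.cast_le.2 (Finset.card_le_card (Finset.union_subset ?_ hAB))) hBd
      intro j hj
      by_contra hjB
      simp [supp, hb j hjB] at hj
  rw [heq]
  exact Set.Finite.isClosed_biUnion (Set.toFinite _) fun B _ => isClosed_vanishing B

end Graph

/-! ### The solution path up to the oracle -/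

section Path

variable {n p : ℕ} {X : Matrix (Fin n) (Fin p) ℝ} {y : Fin n → ℝ} {ρ : ℝ → ℝ}
  {κ γ dstar clow cup lam R τ : ℝ} {A : Finset (Fin p)} {βo b : Fin p → ℝ}

/-- `βo` is a least squares fit on `A`, with large coefficients, whose residual correlates with the
columns of `X` by at most `lam`. -/
structure IsOracleFit (X : Matrix (Fin n) (Fin p) ℝ) (y : Fin n → ℝ) (γ lam : ℝ)
    (A : Finset (Fin p)) (βo : Fin p → ℝ) : Prop where
  eq_zero : ∀ j, j ∉ A → βo j = 0
  le_abs : ∀ j ∈ A, 2 * γ * lam ≤ |βo j|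
  residual_eq_zero : ∀ j ∈ A, (Xᵀ *ᵥ (y - X *ᵥ βo)) j / (n : ℝ) = 0
  residual_le : ∀ j, |(Xᵀ *ᵥ (y - X *ᵥ βo)) j / (n : ℝ)| ≤ lam

/-- The coordinates that may become nonzero near `(τ, b)`. -/
def activeSet (X : Matrix (Fin n) (Fin p) ℝ) (y : Fin n → ℝ) (τ : ℝ) (b : Fin p → ℝ) :
    Finset (Fin p) :=
  Finset.univ.filter fun j => b j ≠ 0 ∨ |score X y τ b j| = 1

theorem isRestrictedSolution_of_mem (hb : (τ, b) ∈ solutionGraph X y ρ) {B : Finset (Fin p)}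
    (hB : supp b ⊆ B) : IsRestrictedSolution X y ρ B τ b := by
  refine ⟨fun j hj => ?_, fun j _ => ((mem_solutionGraph X).1 hb).2 j⟩
  by_contra h0
  exact hj (hB (by simp [supp, h0]))

theorem abs_smul_residual_le (ho : IsOracleFit X y γ lam A βo) (hτ : 0 ≤ τ) (j : Fin p) :
    |τ * ((Xᵀ *ᵥ (y - X *ᵥ βo)) j / (n : ℝ))| ≤ τ * lam := by
  rw [abs_mul, abs_of_nonneg hτ]
  exact mul_le_mul_of_nonneg_left (ho.residual_le j) hτ

/-- The distance of a sparse solution from the oracle. -/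
theorem sum_sq_sub_oracle_le (h : IsRegularPenalty ρ κ γ) (hX : SparseRiesz X dstar clow cup)
    (hκ : κ < clow) (hR : 1 ≤ R) (hR' : ∀ t, 0 < t → |deriv ρ t| ≤ R)
    (ho : IsOracleFit X y γ lam A βo) (hb : (τ, b) ∈ solutionGraph X y ρ) (hτ : τ * lam ≤ 1)
    (hcard : ((supp b ∪ A).card : ℝ) ≤ dstar) :
    ∑ j, (b - τ • βo) j ^ 2 ≤ R ^ 2 / (clow - κ) ^ 2 * A.card := by
  obtain ⟨hτ0, hgrad⟩ := (mem_solutionGraph X).1 hb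
  have hδ := sub_pos.2 hκ
  set H := b - τ • βo with hH
  have hvan : ∀ j, j ∉ supp b ∪ A → H j = 0 := fun j hj => by
    simp only [supp, Finset.mem_union, Finset.mem_filter, Finset.mem_univ, true_and, not_or,
      not_not] at hj
    simp [H, hj.1, ho.eq_zero j hj.2]
  have h1 := (hX.gramForm_bounds hcard hvan).1
  rw [← sum_mul_gram] at h1
  -- On A the residual vanishes, so the Gram response is minus the score, of size at most R. Off A
  -- the scaled residual lies in [-1, 1], hence is a gradient at 0, and monotonicity up to κ
  -- compares it with the score at b.
  have h2 : ∀ j, H j * ((Xᵀ *ᵥ (X *ᵥ H)) j / (n : ℝ)) ≤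
      κ * H j ^ 2 + R * (if j ∈ A then |H j| else 0) := by
    intro j
    have hs := score_eq_residual X y τ b βo j
    by_cases hj : j ∈ A
    · rw [ho.residual_eq_zero j hj] at hs
      have h3 : |(Xᵀ *ᵥ (X *ᵥ H)) j / (n : ℝ)| ≤ R := by
        have := (hgrad j).abs_le hR hR'
        rwa [hs, mul_zero, zero_sub, abs_neg] at this
      have h4 := (le_abs_self _).trans (abs_mul (H j) ((Xᵀ *ᵥ (X *ᵥ H)) j / (n : ℝ))).le
      have h5 := mul_le_mul_of_nonneg_left h3 (abs_nonneg (H j))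
      have h6 := mul_nonneg h.concavity_pos.le (sq_nonneg (H j))
      rw [if_pos hj]
      linarith
    · have h3 : IsPenaltyGradient ρ 0 (τ * ((Xᵀ *ᵥ (y - X *ᵥ βo)) j / (n : ℝ))) :=
        ⟨fun h0 => absurd rfl h0, fun _ => (abs_smul_residual_le ho hτ0 j).trans hτ⟩
      have h4 := IsPenaltyGradient.mul_sub_le h (hgrad j) h3
      have h5 : H j = b j := by simp [H, ho.eq_zero j hj]
      rw [hs, ← h5] at h4
      rw [if_neg hj]
      linarith
  have h3 := Finset.sum_le_sum fun j (_ : j ∈ Finset.univ) => h2 j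
  rw [Finset.sum_add_distrib, ← Finset.mul_sum, ← Finset.mul_sum, Finset.sum_ite_mem,
    Finset.univ_inter] at h3
  set S := ∑ j, H j ^ 2 with hS
  have h4 : (∑ j ∈ A, |H j|) ^ 2 ≤ A.card * S := by
    refine (sq_sum_le_card_mul_sum_sq).trans (mul_le_mul_of_nonneg_left ?_ (Nat.cast_nonneg _))
    simp only [sq_abs]
    exact Finset.sum_le_sum_of_subset_of_nonneg (Finset.subset_univ _) fun _ _ _ => sq_nonneg _
  have hS0 : 0 ≤ S := Finset.sum_nonneg fun _ _ => sq_nonneg _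
  have h5 : ((clow - κ) * S) ^ 2 ≤ R ^ 2 * (A.card * S) := by
    have : (clow - κ) * S ≤ R * ∑ j ∈ A, |H j| := by linarith
    calc ((clow - κ) * S) ^ 2 ≤ (R * ∑ j ∈ A, |H j|) ^ 2 :=
          pow_le_pow_left₀ (mul_nonneg hδ.le hS0) this 2
      _ = R ^ 2 * (∑ j ∈ A, |H j|) ^ 2 := mul_pow _ _ _
      _ ≤ _ := mul_le_mul_of_nonneg_left h4 (sq_nonneg _)
  rw [div_mul_eq_mul_div, le_div_iff₀ (by positivity)]
  rcases hS0.eq_or_lt with h0 | h0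
  · rw [← h0]; simp; positivity
  · refine le_of_mul_le_mul_left ?_ h0
    linarith

theorem card_filter_le_of_sum_sq {ι : Type*} {s : Finset ι} {w : ι → ℝ} {δ C : ℝ} (hδ : 0 < δ)
    (hs : ∀ j ∈ s, δ ≤ |w j|) (hC : ∑ j ∈ s, w j ^ 2 ≤ C) : (s.card : ℝ) ≤ C / δ ^ 2 := by
  rw [le_div_iff₀ (by positivity), ← nsmul_eq_mul]
  refine (Finset.card_nsmul_le_sum s _ _ fun j hj => ?_).trans hC
  rw [← sq_abs (w j)]
  exact pow_le_pow_left₀ hδ.le (hs j hj) 2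

/-- Away from the universal level, sparse solutions have few active coordinates. -/
theorem card_activeSet_union_le (h : IsRegularPenalty ρ κ γ) (hX : SparseRiesz X dstar clow cup)
    (hκ : κ < clow) (hcup : 0 ≤ cup) (hR : 1 ≤ R) (hR' : ∀ t, 0 < t → |deriv ρ t| ≤ R)
    (ho : IsOracleFit X y γ lam A βo) (hb : (τ, b) ∈ solutionGraph X y ρ) (hτ : τ * lam ≤ 1 / 2)
    (hcard : ((supp b ∪ A).card : ℝ) ≤ dstar)
    (hd : 16 * cup ^ 2 * (R ^ 2 / (clow - κ) ^ 2) * A.card + 1 ≤ dstar) :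
    ((activeSet X y τ b ∪ A).card : ℝ) ≤
      (1 + 16 * κ ^ 2 * (R ^ 2 / (clow - κ) ^ 2) + 16 * cup ^ 2 * (R ^ 2 / (clow - κ) ^ 2)) *
        A.card := by
  have hκ0 := h.concavity_pos
  obtain ⟨hτ0, hgrad⟩ := (mem_solutionGraph X).1 hb
  have hsum := sum_sq_sub_oracle_le h hX hκ hR hR' ho hb (hτ.trans (by norm_num)) hcard
  set K := R ^ 2 / (clow - κ) ^ 2
  set H := b - τ • βo with hH
  set g : Fin p → ℝ := fun j => (Xᵀ *ᵥ (X *ᵥ H)) j / (n : ℝ) with hg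
  set S₁ := Finset.univ.filter fun j => 1 / (4 * κ) ≤ |H j|
  set S₂ := Finset.univ.filter fun j => 1 / 4 ≤ |g j|
  have hvan : ∀ j, j ∉ supp b ∪ A → H j = 0 := fun j hj => by
    simp only [supp, Finset.mem_union, Finset.mem_filter, Finset.mem_univ, true_and, not_or,
      not_not] at hj
    simp [H, hj.1, ho.eq_zero j hj.2]
  have hgram : gramForm X H ≤ cup * (K * A.card) :=
    (hX.gramForm_bounds hcard hvan).2.trans (mul_le_mul_of_nonneg_left hsum hcup)
  -- An active coordinate outside A and S₁ has score above 3/4 in absolute value. The residual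
  -- accounts for at most 1/2, leaving more than 1/4 for the Gram response, which puts it in S₂.
  have hsub : activeSet X y τ b ∪ A ⊆ A ∪ S₁ ∪ S₂ := by
    intro j hj
    by_contra hcon
    simp only [S₁, S₂, Finset.mem_union, Finset.mem_filter, Finset.mem_univ, true_and, not_or,
      not_le] at hcon
    obtain ⟨⟨hjA, hjH⟩, hjg⟩ := hcon
    have hact : b j ≠ 0 ∨ |score X y τ b j| = 1 := by
      simpa [activeSet, hjA] using hj
    have h5 : H j = b j := by simp [H, ho.eq_zero j hjA]
    have h1 : 3 / 4 < |score X y τ b j| := by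
      by_cases h0 : b j = 0
      · rw [hact.resolve_left (not_not.2 h0)]; norm_num
      · have h2 := (hgrad j).one_sub_le_abs h h0
        rw [h5, lt_div_iff₀ (by positivity)] at hjH
        linarith
    have h2 := score_eq_residual X y τ b βo j
    have h3 := (abs_smul_residual_le ho hτ0 j).trans hτ
    have h4 := abs_sub (τ * ((Xᵀ *ᵥ (y - X *ᵥ βo)) j / (n : ℝ))) (g j)
    rw [h2] at h1
    change 3 / 4 < |_ - g j| at h1
    linarith
  have hS₁ : (S₁.card : ℝ) ≤ 16 * κ ^ 2 * K * A.card := by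
    have h1 : ∑ j ∈ S₁, H j ^ 2 ≤ K * A.card := le_trans
      (Finset.sum_le_sum_of_subset_of_nonneg (Finset.subset_univ _) fun _ _ _ => sq_nonneg _) hsum
    have := card_filter_le_of_sum_sq (s := S₁) (w := H) (δ := 1 / (4 * κ)) (by positivity)
      (fun j hj => (Finset.mem_filter.1 hj).2) h1
    refine this.trans (le_of_eq ?_)
    field_simp
    ring
  have hS₂ : (S₂.card : ℝ) ≤ 16 * cup ^ 2 * K * A.card := by
    by_contra hcon
    set x := 16 * cup ^ 2 * K * A.card
    have hx : 0 ≤ x := by positivity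
    -- S₂ might be too large for the sparse Riesz condition, so a subset with one element more than
    -- ⌊x⌋ is tested instead; the `+ 1` in `hd` makes it admissible.
    obtain ⟨S, hS, hScard⟩ := Finset.exists_subset_card_eq
      (Nat.succ_le_of_lt ((Nat.floor_lt hx).2 (not_le.1 hcon)))
    have hcardS : (S.card : ℝ) = ⌊x⌋₊ + 1 := by rw [hScard]; push_cast; rfl
    have hle : (S.card : ℝ) ≤ dstar := by
      rw [hcardS]
      exact (add_le_add_left (Nat.floor_le hx) 1).trans hd
    have h1 := (hX.sum_sq_transpose_le hcup hle H).trans (mul_le_mul_of_nonneg_left hgram hcup)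
    have h2 := card_filter_le_of_sum_sq (s := S) (w := g) (δ := 1 / 4) (by norm_num)
      (fun j hj => (Finset.mem_filter.1 (hS hj)).2) h1
    have h3 := Nat.lt_floor_add_one x
    rw [← hcardS] at h3
    have h4 : cup * (cup * (K * A.card)) / (1 / 4) ^ 2 = x := by ring
    linarith
  have h1 : ((activeSet X y τ b ∪ A).card : ℝ) ≤ A.card + S₁.card + S₂.card := by
    exact_mod_cast (Finset.card_le_card hsub).trans ((Finset.card_union_le _ _).trans
      (Nat.add_le_add_right (Finset.card_union_le _ _) _))
  linarith

theorem supp_subset_activeSet : supp b ⊆ activeSet X y τ b := fun j hj => by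
  simp only [supp, activeSet, Finset.mem_filter, Finset.mem_univ, true_and] at hj ⊢
  exact Or.inl hj

/-- The main branch continues beyond a solution with few active coordinates. -/
theorem exists_mem_mainBranch_gt (h : IsRegularPenalty ρ κ γ) (hX : SparseRiesz X dstar clow cup)
    (hκ : κ < clow) (hb : (τ, b) ∈ mainBranch X y ρ)
    (hcard : ((activeSet X y τ b ∪ A).card : ℝ) ≤ dstar) {τ' : ℝ} (hτ' : τ < τ') :
    ∃ t ∈ Set.Ioc τ τ', ∃ c, (t, c) ∈ mainBranch X y ρ ∧ ((supp c ∪ A).card : ℝ) ≤ dstar := by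
  obtain ⟨hτ0, hgrad⟩ := (mem_solutionGraph X).1 (mainBranch_subset hb)
  -- Near τ the restricted solution on B solves the full system: off B the inequalities are strict
  -- at τ and persist by continuity.
  set B := activeSet X y τ b ∪ A
  choose c hc using fun t => exists_isRestrictedSolution (y := y) (B := B) h hX
    (h.concavity_pos.trans hκ) hcard t
  have hcτ : c τ = b := (hc τ).unique h hX hκ hcard (isRestrictedSolution_of_mem
    (mainBranch_subset hb) (supp_subset_activeSet.trans Finset.subset_union_left))
  have hcont : Continuous c := continuous_pi fun j => by
    refine (LipschitzWith.of_dist_le_mul (K := Real.toNNReal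
      (√(∑ j, ((Xᵀ *ᵥ y) j / (n : ℝ)) ^ 2) / (clow - κ))) fun t t' => ?_).continuous
    rw [Real.dist_eq, Real.dist_eq, Real.coe_toNNReal _
      (div_nonneg (Real.sqrt_nonneg _) (sub_pos.2 hκ).le)]
    exact (hc t).abs_sub_le h hX hκ hcard (hc t') j
  have hev : ∀ᶠ t in 𝓝 τ, ∀ j, j ∉ B → |score X y t (c t) j| < 1 := by
    rw [eventually_all]
    intro j
    by_cases hj : j ∈ B
    · exact Eventually.of_forall fun _ hj' => absurd hj hj'
    · have h1 : |score X y τ (c τ) j| < 1 := by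
        rw [hcτ]
        have h2 : b j = 0 ∧ |score X y τ b j| ≠ 1 := by
          simp only [B, activeSet, Finset.mem_union, Finset.mem_filter, Finset.mem_univ, true_and,
            not_or, not_not] at hj
          exact hj.1
        exact lt_of_le_of_ne ((hgrad j).2 h2.1) h2.2
      have h3 : Continuous fun t => |score X y t (c t) j| :=
        ((continuous_score X y j).comp (continuous_id.prodMk hcont)).abs
      filter_upwards [h3.continuousAt.eventually_lt continuousAt_const h1] with t ht _ using ht
  obtain ⟨u, hu, hIcc⟩ := mem_nhdsGE_iff_exists_Ico_subset.1 (nhdsWithin_le_nhds (s := Set.Ici τ) hev)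
  obtain ⟨t, ht1, ht2⟩ := exists_between (lt_min hu hτ')
  refine ⟨t, ⟨ht1, (ht2.trans_le (min_le_right _ _)).le⟩, c t, ?_, ?_⟩
  · refine mem_mainBranch_of_path (f := fun t => (t, c t)) ht1.le
      (continuous_id.prodMk hcont).continuousOn (fun s hs => ?_) (by simpa [hcτ] using hb)
    refine (mem_solutionGraph X).2 ⟨hτ0.trans hs.1, fun j => ?_⟩
    by_cases hj : j ∈ B
    · exact (hc s).2 j hj
    · have h0 := (hc s).1 j hj
      refine ⟨fun h1 => absurd h0 h1, fun _ => ?_⟩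
      exact (hIcc ⟨hs.1, (hs.2.trans_lt ht2).trans_le (min_le_left _ _)⟩ j hj).le
  · refine le_trans (Nat.cast_le.2 (Finset.card_le_card
      (Finset.union_subset ?_ Finset.subset_union_right))) hcard
    intro j hj
    by_contra hjB
    simp [supp, (hc t).1 j hjB] at hj

/-- The bound 2γλ on the coefficients and τλ ≥ 1/2 put the scaled coefficients beyond γ, where the
gradient is 0, matching the normal equations. -/
theorem smul_oracle_mem_solutionGraph (h : IsRegularPenalty ρ κ γ) (hlam : 0 < lam)
    (ho : IsOracleFit X y γ lam A βo) (hτ : 1 / 2 ≤ τ * lam) (hτ' : τ * lam ≤ 1) :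
    (τ, τ • βo) ∈ solutionGraph X y ρ := by
  have hτ0 : 0 ≤ τ := by
    by_contra hneg
    nlinarith [mul_neg_of_neg_of_pos (not_le.1 hneg) hlam]
  refine (mem_solutionGraph X).2 ⟨hτ0, fun j => ?_⟩
  rw [score_eq_residual X y τ _ βo j, sub_self]
  simp only [mulVec_zero, Pi.zero_apply, zero_div, sub_zero]
  by_cases hj : j ∈ A
  · rw [ho.residual_eq_zero j hj, mul_zero]
    refine IsPenaltyGradient.of_large h ?_
    rw [Pi.smul_apply, smul_eq_mul, abs_mul, abs_of_nonneg hτ0]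
    have h1 := mul_le_mul_of_nonneg_left (ho.le_abs j hj) hτ0
    nlinarith [h.pos]
  · have h0 : (τ • βo) j = 0 := by simp [ho.eq_zero j hj]
    exact ⟨fun h1 => absurd h0 h1, fun _ => (abs_smul_residual_le ho hτ0 j).trans hτ'⟩

/-- The oracle lies on the main branch. -/
theorem oracle_mem_mainBranch (h : IsRegularPenalty ρ κ γ) (hX : SparseRiesz X dstar clow cup)
    (hκ : κ < clow) (hcup : 0 ≤ cup) (hR : 1 ≤ R) (hR' : ∀ t, 0 < t → |deriv ρ t| ≤ R)
    (hlam : 0 < lam) (ho : IsOracleFit X y γ lam A βo)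
    (hd : (1 + 16 * κ ^ 2 * (R ^ 2 / (clow - κ) ^ 2) + 16 * cup ^ 2 * (R ^ 2 / (clow - κ) ^ 2)) *
        A.card + 1 ≤ dstar) :
    (lam⁻¹, lam⁻¹ • βo) ∈ mainBranch X y ρ := by
  set K := R ^ 2 / (clow - κ) ^ 2 with hK
  have hK0 : 0 ≤ K := by positivity
  have hA0 : (0 : ℝ) ≤ A.card := Nat.cast_nonneg _
  have hdA : (A.card : ℝ) ≤ dstar := by
    nlinarith [mul_nonneg (by positivity : 0 ≤ 16 * κ ^ 2 * K + 16 * cup ^ 2 * K) hA0]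
  have hd₂ : 16 * cup ^ 2 * K * A.card + 1 ≤ dstar := by
    nlinarith [mul_nonneg (by positivity : 0 ≤ 16 * κ ^ 2 * K) hA0]
  -- Half of 1/λ: up to here the residual leaves slack below the threshold, and from here on the
  -- oracle ray is itself a solution.
  set τ₁ := (2 * lam)⁻¹ with hτ₁
  have hτ₁lam : τ₁ * lam = 1 / 2 := by rw [hτ₁]; field_simp
  have hτ₁0 : 0 ≤ τ₁ := by positivity
  set T : Set ℝ := {τ | ∃ c, (τ, c) ∈ mainBranch X y ρ ∧ ((supp c ∪ A).card : ℝ) ≤ dstar}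
  have hhalf : ∀ τ ∈ Set.Icc 0 τ₁, τ * lam ≤ 1 / 2 := fun τ hτ =>
    hτ₁lam ▸ mul_le_mul_of_nonneg_right hτ.2 hlam.le
  -- The distance bound to the oracle confines sparse solutions to a box, so these levels are the
  -- projection of a compact set.
  have hclosed : IsClosed (T ∩ Set.Icc 0 τ₁) := by
    set W : Fin p → ℝ := fun j => τ₁ * |βo j| + √(K * A.card)
    set Q : Set (ℝ × (Fin p → ℝ)) := (mainBranch X y ρ ∩
      Prod.snd ⁻¹' {c | ((supp c ∪ A).card : ℝ) ≤ dstar}) ∩ Set.Icc 0 τ₁ ×ˢ Set.Icc (-W) W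
    have hQ : IsCompact Q := (isCompact_Icc.prod isCompact_Icc).inter_left
      ((isClosed_mainBranch h).inter ((isClosed_sparse A dstar).preimage continuous_snd))
    have heq : T ∩ Set.Icc 0 τ₁ = Prod.fst '' Q := by
      ext τ
      constructor
      · rintro ⟨⟨c, hc, hcard⟩, hτ⟩
        refine ⟨(τ, c), ⟨⟨hc, hcard⟩, hτ, ?_⟩, rfl⟩
        have hsum := sum_sq_sub_oracle_le h hX hκ hR hR' ho (mainBranch_subset hc)
          ((hhalf τ hτ).trans (by norm_num)) hcard
        have hW : ∀ j, |c j| ≤ W j := fun j => by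
          have h1 : |(c - τ • βo) j| ≤ √(K * A.card) := by
            rw [← Real.sqrt_sq_eq_abs]
            exact Real.sqrt_le_sqrt ((Finset.single_le_sum (f := fun j => (c - τ • βo) j ^ 2)
              (fun _ _ => sq_nonneg _) (Finset.mem_univ j)).trans hsum)
          have h2 : |τ * βo j| ≤ τ₁ * |βo j| := by
            rw [abs_mul, abs_of_nonneg hτ.1]
            exact mul_le_mul_of_nonneg_right hτ.2 (abs_nonneg _)
          have h3 := abs_add_le (τ * βo j) ((c - τ • βo) j)
          simp only [Pi.sub_apply, Pi.smul_apply, smul_eq_mul, add_sub_cancel] at h1 h3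
          simp only [W]
          linarith
        exact ⟨fun j => (abs_le.1 (hW j)).1, fun j => (abs_le.1 (hW j)).2⟩
      · rintro ⟨⟨τ, c⟩, ⟨⟨hc, hcard⟩, hτ, -⟩, rfl⟩
        exact ⟨⟨c, hc, hcard⟩, hτ⟩
    rw [heq]
    exact (hQ.image continuous_fst).isClosed
  -- Continuous induction: a closed set containing 0 and extending to the right of each of its
  -- points fills the interval.
  have hall : Set.Icc 0 τ₁ ⊆ T := by
    refine hclosed.Icc_subset_of_forall_exists_gt ⟨0, zero_mem_mainBranch, by simpa [supp] using hdA⟩ ?_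
    rintro τ ⟨⟨c, hc, hcard⟩, hτ⟩ τ' hτ'
    have hact := card_activeSet_union_le h hX hκ hcup hR hR' ho (mainBranch_subset hc)
      (hhalf τ (Set.Ico_subset_Icc_self hτ)) hcard hd₂
    obtain ⟨t, ht, c', hc', hcard'⟩ := exists_mem_mainBranch_gt h hX hκ hc
      (hact.trans (by linarith)) hτ'
    exact ⟨t, ⟨c', hc', hcard'⟩, ht⟩
  obtain ⟨c, hc, hcard⟩ := hall (Set.right_mem_Icc.2 hτ₁0)
  have hsupp : supp (τ₁ • βo) ⊆ A := fun j hj => by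
    by_contra hjA
    simp [supp, ho.eq_zero j hjA] at hj
  have hceq : c = τ₁ • βo := (isRestrictedSolution_of_mem (mainBranch_subset hc)
    Finset.subset_union_left).unique h hX hκ hcard (isRestrictedSolution_of_mem
      (smul_oracle_mem_solutionGraph h hlam ho hτ₁lam.ge (by rw [hτ₁lam]; norm_num))
      (hsupp.trans Finset.subset_union_right))
  have hle : τ₁ ≤ lam⁻¹ := by
    rw [hτ₁]; exact inv_anti₀ hlam (by linarith)
  refine mem_mainBranch_of_path (f := fun t => (t, t • βo)) hle (by fun_prop) (fun t ht => ?_)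
    (hceq ▸ hc)
  refine smul_oracle_mem_solutionGraph h hlam ho ?_ ?_
  · exact hτ₁lam ▸ mul_le_mul_of_nonneg_right ht.1 hlam.le
  · exact (mul_le_mul_of_nonneg_right ht.2 hlam.le).trans (inv_mul_cancel₀ hlam.ne').le

/-- The oracle is the only PLUS solution. -/
theorem isPlusSolution_iff_eq_oracle (h : IsRegularPenalty ρ κ γ)
    (hX : SparseRiesz X dstar clow cup)
    (hκ : κ < clow) (hcup : 0 ≤ cup) (hR : 1 ≤ R) (hR' : ∀ t, 0 < t → |deriv ρ t| ≤ R)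
    (hlam : 0 < lam) (ho : IsOracleFit X y γ lam A βo)
    (hd : (2 + 16 * κ ^ 2 * (R ^ 2 / (clow - κ) ^ 2) + 16 * cup ^ 2 * (R ^ 2 / (clow - κ) ^ 2)) *
        A.card + 1 ≤ dstar) (β : Fin p → ℝ) :
    IsPlusSolution X y ρ lam β ↔ β = βo := by
  have hA0 : (0 : ℝ) ≤ A.card := Nat.cast_nonneg _
  -- The leading 2 in the constant is for this: two supports of size at most |A| have a union within
  -- the Riesz rank.
  have hd' : 2 * (A.card : ℝ) ≤ dstar := by
    have : 0 ≤ 16 * κ ^ 2 * (R ^ 2 / (clow - κ) ^ 2) + 16 * cup ^ 2 * (R ^ 2 / (clow - κ) ^ 2) := by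
      positivity
    nlinarith [mul_nonneg this hA0]
  have hbranch := oracle_mem_mainBranch h hX hκ hcup hR hR' hlam ho (by linarith)
  have hgraph := mainBranch_subset hbranch
  have hpath : βo ∈ pathSolutions X y ρ lam := ⟨(isKKT_iff hlam βo).2 hgraph, hbranch⟩
  have hsupp : supp βo = A := by
    ext j
    simp only [supp, Finset.mem_filter, Finset.mem_univ, true_and]
    refine ⟨fun hj => by_contra fun hjA => hj (ho.eq_zero j hjA), fun hj h0 => ?_⟩
    have h1 := ho.le_abs j hj
    rw [h0, abs_zero] at h1
    have := h.pos
    linarith [show 0 < 2 * γ * lam by positivity]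
  have hsmul : ∀ β : Fin p → ℝ, supp (lam⁻¹ • β) = supp β := fun β => by
    ext j; simp [supp, hlam.ne']
  have huniq : ∀ β ∈ pathSolutions X y ρ lam, (supp β).card ≤ A.card → β = βo := by
    intro β hβ hcard
    have hB : ((supp β ∪ A).card : ℝ) ≤ dstar := by
      refine le_trans ?_ hd'
      exact_mod_cast (Finset.card_union_le _ _).trans (by omega)
    have := (isRestrictedSolution_of_mem (B := supp β ∪ A) (mainBranch_subset hβ.2)
      (by rw [hsmul]; exact Finset.subset_union_left)).unique h hX hκ hB
      (isRestrictedSolution_of_mem hgraph (by rw [hsmul, hsupp]; exact Finset.subset_union_right))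
    exact smul_right_injective _ (inv_ne_zero hlam.ne') this
  constructor
  · rintro ⟨hβ, hmin⟩
    exact huniq β hβ (hsupp ▸ hmin βo hpath)
  · rintro rfl
    refine ⟨hpath, fun β' hβ' => ?_⟩
    by_contra hlt
    rw [hsupp] at hlt
    have := huniq β' hβ' (not_le.1 hlt).le
    rw [this, hsupp] at hlt
    exact hlt le_rfl

end Path

/-! ### Gaussian tails -/

/-- Beyond t the density is at most x/t times itself, and x exp(-x²/2) has an explicit primitive.
The factor 1/t is essential: at t = √(2 log p) the exponential alone only cancels the p of the union
bound. -/
theorem gaussianReal_Ioi_le {t : ℝ} (ht : 0 < t) :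
    gaussianReal 0 1 (Set.Ioi t) ≤ ENNReal.ofReal ((√(2 * Real.pi))⁻¹ * (Real.exp (-t ^ 2 / 2) / t)) := by
  rw [gaussianReal_apply_eq_integral 0 one_ne_zero]
  refine ENNReal.ofReal_le_ofReal ?_
  have hderiv : ∀ x ∈ Set.Ici t, HasDerivAt (fun x : ℝ => -Real.exp (-x ^ 2 / 2))
      (x * Real.exp (-x ^ 2 / 2)) x := fun x _ => by
    have h1 : HasDerivAt (fun x : ℝ => -x ^ 2 / 2) (-x) x :=
      (((hasDerivAt_id x).pow 2).neg.div_const 2).congr_deriv (by simp; ring)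
    exact h1.exp.neg.congr_deriv (by ring)
  have hnonneg : ∀ x ∈ Set.Ioi t, 0 ≤ x * Real.exp (-x ^ 2 / 2) := fun x hx =>
    mul_nonneg (ht.trans hx).le (Real.exp_pos _).le
  have hlim : Tendsto (fun x : ℝ => -Real.exp (-x ^ 2 / 2)) atTop (𝓝 0) := by
    rw [← neg_zero]
    refine (Real.tendsto_exp_atBot.comp ?_).neg
    have : Tendsto (fun x : ℝ => x ^ 2 / 2) atTop atTop :=
      (tendsto_pow_atTop two_ne_zero).atTop_div_const two_pos
    simpa [neg_div] using this
  have hint := integrableOn_Ioi_deriv_of_nonneg' hderiv hnonneg hlim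
  have hval := integral_Ioi_of_hasDerivAt_of_nonneg' hderiv hnonneg hlim
  rw [zero_sub, neg_neg] at hval
  calc ∫ x in Set.Ioi t, gaussianPDFReal 0 1 x
      ≤ ∫ x in Set.Ioi t, (√(2 * Real.pi))⁻¹ * t⁻¹ * (x * Real.exp (-x ^ 2 / 2)) := by
        refine setIntegral_mono_on (integrable_gaussianPDFReal 0 1).integrableOn
          (hint.const_mul _) measurableSet_Ioi fun x hx => ?_
        have h1 : 1 ≤ t⁻¹ * x := by
          rw [inv_mul_eq_div, one_le_div ht]; exact (Set.mem_Ioi.1 hx).le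
        have h2 : 0 ≤ (√(2 * Real.pi))⁻¹ * Real.exp (-x ^ 2 / 2) := by positivity
        simp only [gaussianPDFReal, NNReal.coe_one, mul_one, sub_zero]
        calc _ ≤ (√(2 * Real.pi))⁻¹ * Real.exp (-x ^ 2 / 2) * (t⁻¹ * x) :=
              le_mul_of_one_le_right h2 h1
          _ = _ := by ring
    _ = _ := by
        rw [integral_const_mul, hval]; ring

theorem gaussianReal_abs_gt_le {t : ℝ} (ht : 0 < t) :
    gaussianReal 0 1 {x | t < |x|} ≤ ENNReal.ofReal (Real.exp (-t ^ 2 / 2) / t) := by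
  have hset : {x : ℝ | t < |x|} = Set.Ioi t ∪ (fun x => -x) ⁻¹' Set.Ioi t := by
    ext x; simp [lt_abs, lt_neg]
  have hneg : gaussianReal 0 1 ((fun x => -x) ⁻¹' Set.Ioi t) = gaussianReal 0 1 (Set.Ioi t) := by
    rw [← Measure.map_apply measurable_neg measurableSet_Ioi, gaussianReal_map_neg, neg_zero]
  have hpi : 2 * (√(2 * Real.pi))⁻¹ ≤ 1 := by
    have : 2 ≤ √(2 * Real.pi) := Real.le_sqrt_of_sq_le (by nlinarith [Real.pi_gt_three])
    rw [← div_eq_mul_inv, div_le_one (by linarith)]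
    exact this
  have h0 : 0 ≤ Real.exp (-t ^ 2 / 2) / t := by positivity
  calc gaussianReal 0 1 {x | t < |x|}
      ≤ gaussianReal 0 1 (Set.Ioi t) + gaussianReal 0 1 (Set.Ioi t) := by
        rw [hset]; exact (measure_union_le _ _).trans (by rw [hneg])
    _ ≤ _ := add_le_add (gaussianReal_Ioi_le ht) (gaussianReal_Ioi_le ht)
    _ ≤ _ := by
        rw [← ENNReal.ofReal_add (by positivity) (by positivity)]
        refine ENNReal.ofReal_le_ofReal ?_
        nlinarith [mul_le_mul_of_nonneg_right hpi h0]

/-- Induction on the set of summands: the new term is independent of the earlier sum, so the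
variances add. -/
theorem noiseLaw_map_sum (n : ℕ) (σ : ℝ) (a : Fin n → ℝ) :
    (noiseLaw n σ).map (fun e => ∑ i, a i * e i) =
      gaussianReal 0 (Real.toNNReal (σ ^ 2 * ∑ i, a i ^ 2)) := by
  set μ := noiseLaw n σ
  have hprob : IsProbabilityMeasure μ := by unfold μ noiseLaw; infer_instance
  have hindep : iIndepFun (fun i (e : Fin n → ℝ) => a i * e i) μ :=
    iIndepFun_pi (X := fun i (x : ℝ) => a i * x) fun i => by fun_prop
  have hone : ∀ i, μ.map (fun e => a i * e i) =
      gaussianReal 0 (Real.toNNReal (σ ^ 2 * a i ^ 2)) := fun i => by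
    have h1 : μ.map (fun e => e i) = gaussianReal 0 (Real.toNNReal (σ ^ 2)) :=
      (measurePreserving_eval (fun _ : Fin n => gaussianReal 0 (Real.toNNReal (σ ^ 2))) i).map_eq
    have h2 : μ.map (fun e => a i * e i) = (μ.map (fun e => e i)).map (a i * ·) := by
      rw [Measure.map_map (by fun_prop) (by fun_prop)]; rfl
    rw [h2, h1, gaussianReal_map_const_mul, mul_zero]
    congr 1
    ext
    simp [sq_nonneg, mul_nonneg, mul_comm]
  have key : ∀ s : Finset (Fin n), μ.map (fun e => ∑ i ∈ s, a i * e i) =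
      gaussianReal 0 (Real.toNNReal (σ ^ 2 * ∑ i ∈ s, a i ^ 2)) := by
    intro s
    induction s using Finset.induction_on with
    | empty => simp
    | insert i s his ih =>
      have h1 := (hindep.indepFun_finsetSum_of_notMem (fun i => by fun_prop) his).symm
      have h2 : (∑ j ∈ s, fun e : Fin n → ℝ => a j * e j) = fun e => ∑ j ∈ s, a j * e j := by
        funext e; simp
      rw [h2] at h1
      have h3 := gaussianReal_add_gaussianReal_of_indepFun h1 (hone i) ih
      rw [add_zero, ← Real.toNNReal_add (by positivity) (by positivity), ← mul_add] at h3
      simp only [Finset.sum_insert his]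
      exact h3
  exact key Finset.univ

/-- Tail bound for a linear functional of the noise with norm at most `√V`. -/
theorem noiseLaw_abs_gt_le {n : ℕ} {σ V t : ℝ} (hσ : 0 < σ) (ht : 0 < t)
    (L : (Fin n → ℝ) →ₗ[ℝ] ℝ) (hL : ∀ e, L e ^ 2 ≤ V * ∑ i, e i ^ 2) :
    noiseLaw n σ {e | σ * √V * t < |L e|} ≤ ENNReal.ofReal (Real.exp (-t ^ 2 / 2) / t) := by
  set a : Fin n → ℝ := fun i => L (Pi.single i 1)
  have hLa : ∀ e, L e = ∑ i, a i * e i := fun e => by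
    rw [L.pi_apply_eq_sum_univ e]
    exact Finset.sum_congr rfl fun i _ => by
      rw [smul_eq_mul, mul_comm]
      congr 2
      ext j; simp [Pi.single_apply, eq_comm]
  set S := ∑ i, a i ^ 2
  -- Testing the bound on the coefficient vector a of L itself gives S² ≤ V S.
  have hS : √S ≤ √V := by
    have h1 := hL a
    rw [hLa a] at h1
    simp only [← sq] at h1
    change S ^ 2 ≤ V * S at h1
    have hS0 : 0 ≤ S := Finset.sum_nonneg fun _ _ => sq_nonneg _
    rcases hS0.eq_or_lt with h0 | h0
    · rw [← h0, Real.sqrt_zero]; exact Real.sqrt_nonneg _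
    · exact Real.sqrt_le_sqrt (le_of_mul_le_mul_right (by linarith) h0)
  have hmeas : MeasurableSet {x : ℝ | σ * √V * t < |x|} :=
    measurableSet_lt measurable_const measurable_abs
  have h1 : noiseLaw n σ {e | σ * √V * t < |L e|} =
      gaussianReal 0 (Real.toNNReal (σ ^ 2 * S)) {x | σ * √V * t < |x|} := by
    rw [← noiseLaw_map_sum, Measure.map_apply (by fun_prop) hmeas]
    simp only [hLa]
    rfl
  have h2 : gaussianReal 0 (Real.toNNReal (σ ^ 2 * S)) =
      (gaussianReal 0 1).map ((σ * √S) * ·) := by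
    rw [gaussianReal_map_const_mul, mul_zero, mul_one]
    congr 1
    ext
    have hS0 : 0 ≤ S := Finset.sum_nonneg fun _ _ => sq_nonneg _
    rw [Real.coe_toNNReal _ (by positivity)]
    change _ = (σ * √S) ^ 2
    rw [mul_pow, Real.sq_sqrt hS0]
  rw [h1, h2, Measure.map_apply (by fun_prop) hmeas]
  refine (measure_mono fun x hx => ?_).trans (gaussianReal_abs_gt_le ht)
  simp only [Set.mem_preimage, Set.mem_ofPred_eq] at hx ⊢
  rw [abs_mul, abs_of_nonneg (by positivity : 0 ≤ σ * √S)] at hx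
  by_contra hcon
  have h3 : σ * √S * |x| ≤ σ * √V * t :=
    mul_le_mul (mul_le_mul_of_nonneg_left hS hσ.le) (not_lt.1 hcon) (abs_nonneg _) (by positivity)
  linarith

/-! ### The oracle least squares estimator -/

section LeastSquares

variable {n p : ℕ} {X : Matrix (Fin n) (Fin p) ℝ} {dstar clow cup : ℝ} {A : Finset (Fin p)}

/-- The least squares estimator as a linear map. -/
def leastSquaresLinear (X : Matrix (Fin n) (Fin p) ℝ) (A : Finset (Fin p)) :
    (Fin n → ℝ) →ₗ[ℝ] (Fin p → ℝ) where
  toFun := leastSquares X A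
  map_add' y y' := by
    funext j
    by_cases hj : j ∈ A <;> simp [leastSquares, hj, mulVec_add]
  map_smul' r y := by
    funext j
    by_cases hj : j ∈ A <;> simp [leastSquares, hj, mulVec_smul]

theorem leastSquares_eq_zero {y : Fin n → ℝ} {j : Fin p} (hj : j ∉ A) :
    leastSquares X A y j = 0 := by
  simp [leastSquares, hj]

theorem submatrix_mulVec_restrict {b : Fin p → ℝ} (hb : ∀ j, j ∉ A → b j = 0) :
    (X.submatrix id (Subtype.val : {j // j ∈ A} → Fin p)) *ᵥ (fun j => b j) = X *ᵥ b := by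
  funext i
  simp only [mulVec, dotProduct, submatrix_apply, id]
  rw [Finset.sum_coe_sort A fun j => X i j * b j]
  exact Finset.sum_subset (Finset.subset_univ _) fun j _ hj => by simp [hb j hj]

/-- A kernel vector of the Gram matrix has zero fit, and the lower Riesz bound forces it to vanish.
-/
theorem SparseRiesz.isUnit_gram (h : SparseRiesz X dstar clow cup) (hclow : 0 < clow)
    (hA : (A.card : ℝ) ≤ dstar) :
    IsUnit ((X.submatrix id (Subtype.val : {j // j ∈ A} → Fin p))ᵀ *
      X.submatrix id (Subtype.val : {j // j ∈ A} → Fin p)) := by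
  set XA := X.submatrix id (Subtype.val : {j // j ∈ A} → Fin p)
  rw [← mulVec_injective_iff_isUnit, ← coe_mulVecLin, injective_iff_map_eq_zero]
  intro w hw
  rw [mulVecLin_apply] at hw
  set b : Fin p → ℝ := fun j => if hj : j ∈ A then w ⟨j, hj⟩ else 0
  have hb : ∀ j, j ∉ A → b j = 0 := fun j hj => dif_neg hj
  have hbw : (fun j : {j // j ∈ A} => b j) = w := by
    funext j; simp [b]
  have h1 : (XA *ᵥ w) ⬝ᵥ (XA *ᵥ w) = 0 := by
    rw [dotProduct_mulVec, vecMul_mulVec, ← dotProduct_mulVec, hw, dotProduct_zero]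
  have h2 : XA *ᵥ w = 0 := dotProduct_self_eq_zero.1 h1
  rw [← hbw, submatrix_mulVec_restrict hb] at h2
  have h3 := (h.gramForm_bounds hA hb).1
  simp only [gramForm, h2, Pi.zero_apply] at h3
  have h4 : ∑ j, b j ^ 2 = 0 := by
    refine le_antisymm ?_ (Finset.sum_nonneg fun _ _ => sq_nonneg _)
    refine nonpos_of_mul_nonpos_right (h3.trans ?_) hclow
    simp
  funext j
  have := (Finset.sum_eq_zero_iff_of_nonneg fun j _ => sq_nonneg (b j)).1 h4 j (Finset.mem_univ _)
  rw [← hbw]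
  simpa using this

theorem mulVec_leastSquares (y : Fin n → ℝ) :
    X *ᵥ leastSquares X A y = (X.submatrix id (Subtype.val : {j // j ∈ A} → Fin p)) *ᵥ
      (((X.submatrix id (Subtype.val : {j // j ∈ A} → Fin p))ᵀ *
        X.submatrix id (Subtype.val : {j // j ∈ A} → Fin p))⁻¹ *ᵥ
        ((X.submatrix id (Subtype.val : {j // j ∈ A} → Fin p))ᵀ *ᵥ y)) := by
  rw [← submatrix_mulVec_restrict fun j hj => leastSquares_eq_zero hj]
  congr 1
  funext j
  simp [leastSquares]

/-- The normal equations. -/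
theorem SparseRiesz.transpose_mulVec_residual (h : SparseRiesz X dstar clow cup) (hclow : 0 < clow)
    (hA : (A.card : ℝ) ≤ dstar) (y : Fin n → ℝ) {j : Fin p} (hj : j ∈ A) :
    (Xᵀ *ᵥ (y - X *ᵥ leastSquares X A y)) j = 0 := by
  have hu := h.isUnit_gram hclow hA
  rw [mulVec_leastSquares]
  set XA := X.submatrix id (Subtype.val : {j // j ∈ A} → Fin p) with hXA
  have h1 : XAᵀ *ᵥ (y - XA *ᵥ ((XAᵀ * XA)⁻¹ *ᵥ (XAᵀ *ᵥ y))) = 0 := by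
    rw [mulVec_sub, mulVec_mulVec, mulVec_mulVec,
      mul_nonsing_inv _ ((isUnit_iff_isUnit_det _).1 hu), one_mulVec, sub_self]
  exact congrFun h1 ⟨j, hj⟩

theorem SparseRiesz.leastSquares_mulVec (h : SparseRiesz X dstar clow cup) (hclow : 0 < clow)
    (hA : (A.card : ℝ) ≤ dstar) {β : Fin p → ℝ} (hβ : ∀ j, j ∉ A → β j = 0) :
    leastSquares X A (X *ᵥ β) = β := by
  have hu := h.isUnit_gram hclow hA
  funext j
  by_cases hj : j ∈ A
  · simp only [leastSquares, hj, dif_pos]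
    rw [← submatrix_mulVec_restrict hβ, mulVec_mulVec _ (X.submatrix id Subtype.val)ᵀ,
      mulVec_mulVec,
      nonsing_inv_mul _ ((isUnit_iff_isUnit_det _).1 hu), one_mulVec]
  · rw [leastSquares_eq_zero hj, hβ j hj]

/-- Pythagoras for the least squares fit. -/
theorem SparseRiesz.sum_sq_fit_add (h : SparseRiesz X dstar clow cup) (hclow : 0 < clow)
    (hA : (A.card : ℝ) ≤ dstar) (e : Fin n → ℝ) :
    ∑ i, (X *ᵥ leastSquares X A e) i ^ 2 + ∑ i, (e - X *ᵥ leastSquares X A e) i ^ 2 =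
      ∑ i, e i ^ 2 := by
  set f := X *ᵥ leastSquares X A e
  have h1 : f ⬝ᵥ (e - f) = 0 := by
    have : leastSquares X A e ⬝ᵥ (Xᵀ *ᵥ (e - f)) = 0 := by
      refine Finset.sum_eq_zero fun j _ => ?_
      by_cases hj : j ∈ A
      · rw [h.transpose_mulVec_residual hclow hA e hj, mul_zero]
      · rw [leastSquares_eq_zero hj, zero_mul]
    rwa [dotProduct_mulVec, vecMul_transpose] at this
  have h2 : ∑ i, e i ^ 2 = ∑ i, f i ^ 2 + ∑ i, (e - f) i ^ 2 + 2 * (f ⬝ᵥ (e - f)) := by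
    rw [dotProduct, Finset.mul_sum, ← Finset.sum_add_distrib, ← Finset.sum_add_distrib]
    exact Finset.sum_congr rfl fun i _ => by simp only [Pi.sub_apply]; ring
  rw [h2, h1]; ring

theorem SparseRiesz.sq_leastSquares_le (h : SparseRiesz X dstar clow cup) (hclow : 0 < clow)
    (hn : 0 < n) (hA : (A.card : ℝ) ≤ dstar) (e : Fin n → ℝ) (j : Fin p) :
    leastSquares X A e j ^ 2 ≤ 1 / (n * clow) * ∑ i, e i ^ 2 := by
  have hn' : (0 : ℝ) < n := Nat.cast_pos.2 hn
  have h1 := (h.gramForm_bounds hA (b := leastSquares X A e) fun j hj => leastSquares_eq_zero hj).1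
  have h2 := h.sum_sq_fit_add hclow hA e
  have h3 : 0 ≤ ∑ i, (e - X *ᵥ leastSquares X A e) i ^ 2 :=
    Finset.sum_nonneg fun _ _ => sq_nonneg _
  have h4 := Finset.single_le_sum (f := fun j => leastSquares X A e j ^ 2)
    (fun _ _ => sq_nonneg _) (Finset.mem_univ j)
  rw [gramForm, le_div_iff₀ hn'] at h1
  rw [div_mul_eq_mul_div, one_mul, le_div_iff₀ (by positivity)]
  have h5 := mul_le_mul_of_nonneg_right h4 (by positivity : 0 ≤ n * clow)
  linarith

theorem SparseRiesz.sq_residual_le (h : SparseRiesz X dstar clow cup) (hclow : 0 < clow)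
    (hn : 0 < n) (hX : Standardized X) (hA : (A.card : ℝ) ≤ dstar) (e : Fin n → ℝ) (j : Fin p) :
    ((Xᵀ *ᵥ (e - X *ᵥ leastSquares X A e)) j / (n : ℝ)) ^ 2 ≤ 1 / n * ∑ i, e i ^ 2 := by
  have hn' : (0 : ℝ) < n := Nat.cast_pos.2 hn
  have h2 := h.sum_sq_fit_add hclow hA e
  have h3 : 0 ≤ ∑ i, (X *ᵥ leastSquares X A e) i ^ 2 := Finset.sum_nonneg fun _ _ => sq_nonneg _
  set r := e - X *ᵥ leastSquares X A e
  have h4 : (Xᵀ *ᵥ r) j ^ 2 ≤ (∑ i, X i j ^ 2) * ∑ i, r i ^ 2 :=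
    Finset.sum_mul_sq_le_sq_mul_sq Finset.univ (fun i => X i j) r
  rw [(div_eq_one_iff_eq hn'.ne').1 (hX j)] at h4
  rw [div_pow, div_le_iff₀ (by positivity)]
  have h5 : (n : ℝ) * ∑ i, r i ^ 2 ≤ n * ∑ i, e i ^ 2 :=
    mul_le_mul_of_nonneg_left (by linarith) hn'.le
  refine (h4.trans h5).trans (le_of_eq ?_)
  field_simp

end LeastSquares

/-! ### The good event -/

section Event

variable {n p : ℕ} {X : Matrix (Fin n) (Fin p) ℝ} {dstar clow cup σ t : ℝ} {β : Fin p → ℝ}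

/-- The noise vectors for which the oracle is close to the truth and its residual is small. -/
def goodNoise (X : Matrix (Fin n) (Fin p) ℝ) (A : Finset (Fin p)) (clow σ t : ℝ) :
    Set (Fin n → ℝ) :=
  {e | ∀ j, (j ∈ A → |leastSquares X A e j| ≤ σ * √(1 / (n * clow)) * t) ∧
    (j ∉ A → |(Xᵀ *ᵥ (e - X *ᵥ leastSquares X A e)) j / (n : ℝ)| ≤ σ * √(1 / n) * t)}

theorem measurableSet_goodNoise (A : Finset (Fin p)) : MeasurableSet (goodNoise X A clow σ t) := by
  have hcont : Continuous (leastSquares X A) :=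
    (leastSquaresLinear X A).continuous_of_finiteDimensional
  have heq : goodNoise X A clow σ t =
      ⋂ j, {e | (j ∈ A → |leastSquares X A e j| ≤ σ * √(1 / (n * clow)) * t) ∧
    (j ∉ A → |(Xᵀ *ᵥ (e - X *ᵥ leastSquares X A e)) j / (n : ℝ)| ≤ σ * √(1 / n) * t)} := by
    ext; simp [goodNoise]
  rw [heq]
  refine MeasurableSet.iInter fun j => ?_
  by_cases hj : j ∈ A
  · simp only [hj, true_imp_iff, not_true_eq_false, false_imp_iff, and_true]
    exact (isClosed_le (by fun_prop) continuous_const).measurableSet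
  · simp only [hj, true_imp_iff, not_false_eq_true, false_imp_iff, true_and]
    exact (isClosed_le (by fun_prop) continuous_const).measurableSet

/-- Each index carries one event, the coefficient error on A or the residual correlation off A, so
the union bound costs a factor p. -/
theorem noiseLaw_goodNoise_compl_le (h : SparseRiesz X dstar clow cup) (hclow : 0 < clow)
    (hn : 0 < n) (hσ : 0 < σ) (ht : 0 < t) (hX : Standardized X) {A : Finset (Fin p)}
    (hA : (A.card : ℝ) ≤ dstar) :
    noiseLaw n σ (goodNoise X A clow σ t)ᶜ ≤
      ENNReal.ofReal (p * (Real.exp (-t ^ 2 / 2) / t)) := by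
  have hsub : (goodNoise X A clow σ t)ᶜ ⊆ ⋃ j, {e |
      (j ∈ A ∧ σ * √(1 / (n * clow)) * t < |leastSquares X A e j|) ∨
      (j ∉ A ∧ σ * √(1 / n) * t < |(Xᵀ *ᵥ (e - X *ᵥ leastSquares X A e)) j / (n : ℝ)|)} := by
    intro e he
    simp only [goodNoise, Set.mem_compl_iff, Set.mem_ofPred_eq, not_forall] at he
    obtain ⟨j, hj⟩ := he
    refine Set.mem_iUnion.2 ⟨j, ?_⟩
    simp only [Set.mem_ofPred_eq]
    by_cases hjA : j ∈ A
    · simpa [hjA] using hj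
    · simpa [hjA] using hj
  have hone : ∀ j, noiseLaw n σ {e |
      (j ∈ A ∧ σ * √(1 / (n * clow)) * t < |leastSquares X A e j|) ∨
      (j ∉ A ∧ σ * √(1 / n) * t < |(Xᵀ *ᵥ (e - X *ᵥ leastSquares X A e)) j / (n : ℝ)|)} ≤
      ENNReal.ofReal (Real.exp (-t ^ 2 / 2) / t) := by
    intro j
    by_cases hj : j ∈ A
    · simp only [hj, true_and, not_true_eq_false, false_and, or_false]
      exact noiseLaw_abs_gt_le hσ ht (LinearMap.proj j ∘ₗ leastSquaresLinear X A)
        fun e => h.sq_leastSquares_le hclow hn hA e j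
    · simp only [hj, true_and, not_false_eq_true, false_and, false_or]
      have := noiseLaw_abs_gt_le (V := 1 / n) hσ ht ((n : ℝ)⁻¹ • (LinearMap.proj j ∘ₗ Xᵀ.mulVecLin ∘ₗ
        (LinearMap.id - X.mulVecLin ∘ₗ leastSquaresLinear X A))) fun e => by
          have := h.sq_residual_le hclow hn hX hA e j
          rw [div_eq_inv_mul] at this
          exact this
      simp only [div_eq_inv_mul _ (n : ℝ)] at this ⊢
      exact this
  refine (measure_mono hsub).trans ((measure_iUnion_le _).trans ?_)
  rw [tsum_fintype]
  refine (Finset.sum_le_sum fun j _ => hone j).trans ?_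
  rw [Finset.sum_const, Finset.card_univ, Fintype.card_fin, nsmul_eq_mul,
    ENNReal.ofReal_mul (Nat.cast_nonneg _), ENNReal.ofReal_natCast]

theorem le_abs_of_le_minSignal {c : ℝ} (h : (c : WithTop ℝ) ≤ minSignal β) {j : Fin p}
    (hj : j ∈ supp β) : c ≤ |β j| :=
  WithTop.coe_le_coe.1 (h.trans (Finset.inf_le hj))

theorem supp_eq_of_sgn_eq {β β' : Fin p → ℝ} (h : sgn β = sgn β') : supp β = supp β' := by
  ext j
  have := congrFun h j
  simp only [sgn] at this
  simp only [supp, Finset.mem_filter, Finset.mem_univ, true_and, ne_eq]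
  rw [← Real.sign_eq_zero_iff, this, Real.sign_eq_zero_iff]

theorem sign_eq_of_abs_sub_lt {x x' : ℝ} (h : |x - x'| < |x'|) : Real.sign x = Real.sign x' := by
  rcases lt_trichotomy x' 0 with h0 | h0 | h0
  · rw [abs_of_neg h0] at h
    rw [Real.sign_of_neg h0, Real.sign_of_neg (by linarith [le_abs_self (x - x')])]
  · simp [h0] at h
    exact absurd h (not_lt.2 (abs_nonneg _))
  · rw [abs_of_pos h0] at h
    rw [Real.sign_of_pos h0, Real.sign_of_pos (by linarith [neg_abs_le (x - x')])]

/-- On the good event the oracle has the properties that put it on the solution path, and the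
right signs. -/
theorem isOracleFit_of_mem_goodNoise {γ : ℝ} (h : SparseRiesz X dstar clow cup) (hclow : 0 < clow)
    (hγ : 0 < γ) (hn : 0 < n) (hp : 2 ≤ p) (hσ : 0 < σ)
    (hA : ((supp β).card : ℝ) ≤ dstar)
    (hβ : (((2 * √2 * γ + √2 * √(1 / clow)) * σ * √((1 + Real.log p) / n) : ℝ) : WithTop ℝ) ≤
      minSignal β) {e : Fin n → ℝ}
    (he : e ∈ goodNoise X (supp β) clow σ (√(2 * Real.log p))) :
    IsOracleFit X (X *ᵥ β + e) γ (universalLevel σ n p) (supp β)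
        (leastSquares X (supp β) (X *ᵥ β + e)) ∧
      sgn (leastSquares X (supp β) (X *ᵥ β + e)) = sgn β := by
  have hn' : (0 : ℝ) < n := Nat.cast_pos.2 hn
  have hlog : 0 < Real.log p := Real.log_pos (by exact_mod_cast hp)
  set A := supp β with hAdef
  have hβA : ∀ j, j ∉ A → β j = 0 := fun j hj => by
    by_contra h0; exact hj (by simp [A, supp, h0])
  have hls : leastSquares X A (X *ᵥ β + e) = β + leastSquares X A e := by
    conv_rhs => rw [← h.leastSquares_mulVec hclow hA hβA]
    exact (leastSquaresLinear X A).map_add _ _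
  have hres : X *ᵥ β + e - X *ᵥ leastSquares X A (X *ᵥ β + e) = e - X *ᵥ leastSquares X A e := by
    rw [hls, mulVec_add]; abel
  have hlam : σ * √(1 / n) * √(2 * Real.log p) = universalLevel σ n p := by
    rw [universalLevel, mul_assoc, ← Real.sqrt_mul (by positivity)]
    congr 2; ring
  have hlampos : 0 < universalLevel σ n p := by
    rw [universalLevel]; positivity
  -- The two terms of the signal constant are 2γ times the universal level and the largest
  -- coefficient error on the good event.
  have hsignal : ∀ j ∈ A, 2 * γ * universalLevel σ n p +
      σ * √(1 / (n * clow)) * √(2 * Real.log p) < |β j| := fun j hj => by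
    refine lt_of_lt_of_le ?_ (le_abs_of_le_minSignal hβ hj)
    have h1 : √(2 * Real.log p / n) = √2 * √(Real.log p / n) := by
      rw [← Real.sqrt_mul (by positivity)]; congr 1; ring
    have h2 : √(1 / (n * clow)) * √(2 * Real.log p) = √2 * √(1 / clow) * √(Real.log p / n) := by
      rw [← Real.sqrt_mul (by positivity), ← Real.sqrt_mul (by positivity),
        ← Real.sqrt_mul (by positivity)]
      congr 1; field_simp
    have h3 : √(Real.log p / n) < √((1 + Real.log p) / n) :=
      Real.sqrt_lt_sqrt (by positivity) (div_lt_div_of_pos_right (by linarith) hn')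
    rw [universalLevel, h1, mul_assoc σ (√(1 / (n * clow))), h2]
    calc _ = (2 * √2 * γ + √2 * √(1 / clow)) * σ * √(Real.log p / n) := by ring
      _ < _ := mul_lt_mul_of_pos_left h3 (by positivity)
  have hdev : ∀ j ∈ A, |leastSquares X A e j| ≤ σ * √(1 / (n * clow)) * √(2 * Real.log p) :=
    fun j hj => (he j).1 hj
  refine ⟨⟨fun j hj => leastSquares_eq_zero hj, fun j hj => ?_, fun j hj => ?_, fun j => ?_⟩, ?_⟩
  · have h1 := hsignal j hj
    have h2 := hdev j hj
    have h3 := abs_sub_abs_le_abs_sub (β j) (-leastSquares X A e j)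
    rw [hls, Pi.add_apply]
    rw [abs_neg, sub_neg_eq_add] at h3
    linarith
  · rw [h.transpose_mulVec_residual hclow hA _ hj, zero_div]
  · by_cases hj : j ∈ A
    · rw [h.transpose_mulVec_residual hclow hA _ hj, zero_div, abs_zero]
      exact hlampos.le
    · rw [hres, ← hlam]
      exact (he j).2 hj
  · funext j
    simp only [sgn]
    by_cases hj : j ∈ A
    · refine sign_eq_of_abs_sub_lt ?_
      rw [hls, Pi.add_apply, add_sub_cancel_left]
      have h1 := hsignal j hj
      have h2 := hdev j hj
      linarith [show 0 < 2 * γ * universalLevel σ n p by positivity]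
    · rw [leastSquares_eq_zero hj, hβA j hj]

end Event

end PlusSelection

end

/-! ### The selection theorem -/

theorem theorem1 (m : ℕ) (ρm : ℝ → ℝ) (hspline : PlusSelection.IsQuadraticSpline m ρm)
    (hρ : PlusSelection.UnbiasedSelection (PlusSelection.penalty ρm))
    (clow cup : ℝ) (hκ : PlusSelection.maxConcavity (PlusSelection.penalty ρm) 1 < clow) :
    ∃ M₁ M₂ : ℝ, 0 < M₁ ∧ 0 < M₂ ∧
      ∀ (n p : ℕ → ℕ) (X : ∀ k, Matrix (Fin (n k)) (Fin (p k)) ℝ) (β : ∀ k, Fin (p k) → ℝ)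
        (σ dstar : ℕ → ℝ)
        (Ω : ℕ → Type*) (mΩ : ∀ k, MeasurableSpace (Ω k)) (P : ∀ k, Measure (Ω k))
        (ε : ∀ k, Ω k → Fin (n k) → ℝ) (y : ∀ k, Ω k → Fin (n k) → ℝ)
        (est : ∀ k, (Fin (n k) → ℝ) → (Fin (p k) → ℝ)),
        (∀ k, 0 < n k) → (∀ k, 0 < σ k) →
        (∀ k, HasLaw (ε k) (PlusSelection.noiseLaw (n k) (σ k)) (P k)) →
        (∀ k ω, y k ω = X k *ᵥ β k + ε k ω) →
        (∀ k, PlusSelection.Standardized (X k)) →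
        (∀ k, PlusSelection.SparseRiesz (X k) (dstar k) clow cup) →
        (∀ k, ((M₁ * σ k * √((1 + Real.log (p k)) / n k) : ℝ) : WithTop ℝ) ≤
          PlusSelection.minSignal (β k)) →
        (∀ k, M₂ * ((PlusSelection.supp (β k)).card : ℝ) + 1 ≤ dstar k) →
        (∀ k, PlusSelection.IsPlusEstimator (X k) ρm
          (PlusSelection.universalLevel (σ k) (n k) (p k)) (est k)) →
        Tendsto p atTop atTop →
        (∀ k, P k {ω | PlusSelection.supp (est k (y k ω)) ≠ PlusSelection.supp (β k)} ≤
          P k {ω | est k (y k ω) ≠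
                PlusSelection.leastSquares (X k) (PlusSelection.supp (β k)) (y k ω) ∨
              PlusSelection.sgn (est k (y k ω)) ≠ PlusSelection.sgn (β k)}) ∧
        Tendsto (fun k => P k {ω | est k (y k ω) ≠
                PlusSelection.leastSquares (X k) (PlusSelection.supp (β k)) (y k ω) ∨
              PlusSelection.sgn (est k (y k ω)) ≠ PlusSelection.sgn (β k)}) atTop (𝓝 0) ∧
        Tendsto (fun k => P k {ω | ¬ ∃! b, PlusSelection.IsPlusSolution (X k) (y k ω) ρm
            (PlusSelection.universalLevel (σ k) (n k) (p k)) b}) atTop (𝓝 0) := by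
  obtain ⟨γ, hreg⟩ := hspline.exists_isRegularPenalty hρ
  obtain ⟨R, hR, hR'⟩ := hreg.exists_abs_deriv_le
  set κ := PlusSelection.maxConcavity (PlusSelection.penalty ρm) 1
  have hκ0 := hreg.concavity_pos
  have hclow : 0 < clow := hκ0.trans hκ
  have hγ := hreg.pos
  refine ⟨2 * √2 * γ + √2 * √(1 / clow),
    2 + 16 * κ ^ 2 * (R ^ 2 / (clow - κ) ^ 2) + 16 * cup ^ 2 * (R ^ 2 / (clow - κ) ^ 2),
    by positivity, by positivity, ?_⟩
  intro n p X β σ dstar Ω mΩ P ε y est hn hσ hε hy hstd hX hβ hd hest hp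
  refine ⟨fun k => measure_mono fun ω hω => Or.inr fun hs => hω (PlusSelection.supp_eq_of_sgn_eq hs),
    ?_⟩
  set bad : ∀ k, Set (Ω k) := fun k => {ω | ε k ω ∈ (PlusSelection.goodNoise (X k)
    (PlusSelection.supp (β k)) clow (σ k) (√(2 * Real.log (p k))))ᶜ}
  have hlog : Tendsto (fun k => √(2 * Real.log (p k))) atTop atTop :=
    Real.tendsto_sqrt_atTop.comp ((Real.tendsto_log_atTop.comp
      (tendsto_natCast_atTop_atTop.comp hp)).const_mul_atTop two_pos)
  have hcard : ∀ k, ((PlusSelection.supp (β k)).card : ℝ) ≤ dstar k ∧ 1 ≤ dstar k := fun k => by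
    have h0 : (0 : ℝ) ≤ (PlusSelection.supp (β k)).card := Nat.cast_nonneg _
    have h1 : 0 ≤ (1 + 16 * κ ^ 2 * (R ^ 2 / (clow - κ) ^ 2) +
      16 * cup ^ 2 * (R ^ 2 / (clow - κ) ^ 2)) * (PlusSelection.supp (β k)).card := by positivity
    constructor <;> linarith [hd k]
  -- With t = √(2 log p) the tail bound p exp(-t²/2)/t equals 1/t.
  have hbad : Tendsto (fun k => P k (bad k)) atTop (𝓝 0) := by
    have hlim : Tendsto (fun k => ENNReal.ofReal ((√(2 * Real.log (p k)))⁻¹)) atTop (𝓝 0) := by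
      simpa using ENNReal.tendsto_ofReal hlog.inv_tendsto_atTop
    refine tendsto_of_tendsto_of_tendsto_of_le_of_le' tendsto_const_nhds hlim
      (Eventually.of_forall fun _ => zero_le) ?_
    filter_upwards [hp.eventually_ge_atTop 2] with k hk
    have hpk : (0 : ℝ) < p k := by exact_mod_cast (by omega : 0 < p k)
    have hlogk : 0 < Real.log (p k) := Real.log_pos (by exact_mod_cast hk)
    refine ((hε k).measure_eq (PlusSelection.measurableSet_goodNoise _).compl).le.trans ?_
    refine (PlusSelection.noiseLaw_goodNoise_compl_le (hX k) hclow (hn k) (hσ k) (by positivity)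
      (hstd k) (hcard k).1).trans (le_of_eq ?_)
    rw [Real.sq_sqrt (by positivity), neg_div, mul_div_cancel_left₀ _ (two_ne_zero' ℝ),
      Real.exp_neg, Real.exp_log hpk]
    congr 1
    field_simp
  have hgood : ∀ᶠ k in atTop, ∀ ω, ω ∉ bad k →
      (∀ b, PlusSelection.IsPlusSolution (X k) (y k ω) ρm
        (PlusSelection.universalLevel (σ k) (n k) (p k)) b ↔
          b = PlusSelection.leastSquares (X k) (PlusSelection.supp (β k)) (y k ω)) ∧
      PlusSelection.sgn (PlusSelection.leastSquares (X k) (PlusSelection.supp (β k)) (y k ω)) =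
        PlusSelection.sgn (β k) := by
    filter_upwards [hp.eventually_ge_atTop 2] with k hk ω hω
    have hlogk : 0 < Real.log (p k) := Real.log_pos (by exact_mod_cast hk)
    have hlam : 0 < PlusSelection.universalLevel (σ k) (n k) (p k) :=
      mul_pos (hσ k) (Real.sqrt_pos.2 (div_pos (by positivity) (Nat.cast_pos.2 (hn k))))
    -- The Riesz bounds on a single column give clow ≤ cup; the `+ 1` in the rank condition permits
    -- a singleton even when the true support is empty.
    have hcup : 0 ≤ cup :=
      hclow.le.trans ((hX k).clow_le_cup (hcard k).2 ⟨0, by omega⟩)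
    obtain ⟨hfit, hsgn⟩ := PlusSelection.isOracleFit_of_mem_goodNoise (hX k) hclow hγ (hn k) hk
      (hσ k) (hcard k).1 (hβ k) (not_not.1 hω)
    rw [hy k ω]
    exact ⟨fun b => PlusSelection.isPlusSolution_iff_eq_oracle hreg (hX k) hκ hcup hR hR' hlam hfit
      (hd k) b, hsgn⟩
  constructor
  · refine tendsto_of_tendsto_of_tendsto_of_le_of_le' tendsto_const_nhds hbad
      (Eventually.of_forall fun _ => zero_le) ?_
    filter_upwards [hgood] with k hk
    refine measure_mono fun ω hω => ?_
    by_contra hgoodω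
    obtain ⟨hiff, hsgn⟩ := hk ω hgoodω
    have heq := (hiff _).1 (hest k (y k ω) ⟨_, (hiff _).2 rfl⟩)
    rcases hω with h1 | h1
    · exact h1 heq
    · exact h1 (heq ▸ hsgn)
  · refine tendsto_of_tendsto_of_tendsto_of_le_of_le' tendsto_const_nhds hbad
      (Eventually.of_forall fun _ => zero_le) ?_
    filter_upwards [hgood] with k hk
    refine measure_mono fun ω hω => ?_
    by_contra hgoodω
    obtain ⟨hiff, -⟩ := hk ω hgoodω
    exact hω ⟨_, (hiff _).2 rfl, fun b hb => (hiff b).1 hb⟩
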